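/- Let $m,n$ be positive integers with $m\mid n$, put $s=n/m$, let $q\in\mathbb{C}$ be a primitive $m$-th root of $1$, let $\zeta\in\mathbb{C}$ be a primitive $n$-th root of $1$ with $\zeta^{s}=q$, and let $\alpha\in\mathbb{C}$ be nonzero. Let $$T=T(n,m,\alpha)=\mathbb{C}\langle x,g\rangle/(x^m-\alpha(1-g^m),\ g^n-1,\ gxg^{-1}-qx)$$ be the generalized Taft Hopf algebra, with $\Delta(g)=g\otimes g$ and $\Delta(x)=x\otimes 1+g\otimes x$; it has dimension $nm$. Let $L$ be the splitting field of $(X^m-1)^{s}-w$ over $\mathbb{C}(w)$. There are $y\in L$ with $y^s=w$ and elements $c_j\in L$ $(j\in\mathbb{Z}/s)$ with $c_j^m-\zeta^{jm}y-1=0$; fix any such choice. Then there is exactly one automorphism $\sigma$ of $L$ over $\mathbb{C}(w)$ with $\sigma(c_j)=c_{j+1}$ for all $j$. Let $L[t;\sigma]$ be the Ore extension with relation $at=t\sigma(a)$ for $a\in L$, and let $Q=\mathrm{Frac}(L[t;\sigma])$ be its localization at the nonzero central elements. Then $Q$ is a division algebra which is finite-dimensional over its center. For every $i\in\mathbb{Z}/s$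 and every $\beta\in\mathbb{C}$ with $\beta^m=\alpha$ there is a $T$-module algebra structure on $Q$ with $g\cdot c_j=qc_j$ for all $j$, $g\cdot t=\zeta t$, and $x\cdot a=\beta\,(c_ia-(g\cdot a)c_i)$ for all $a\in Q$, such that: 1. the action is inner faithful, i.e. it does not factor through a proper Hopf quotient of $T$; 2. $Q$ has rank $sm$ as a left module over the invariants $Q^{T}$; 3. if $m\ge 2$, then $sm<nm=\dim T$ and the action is not Hopf-Galois, i.e. for the corresponding coaction $\delta:Q\to Q\otimes T^*$ the map $Q\otimes_{Q^T}Q\to Q\otimes T^*$, $a\otimes b\mapsto (a\otimes 1)\delta(b)$, is not bijective. -/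

import Mathlib

open scoped TensorProduct

noncomputable section

/-- The Gaussian binomial coefficients, through the `q`-Pascal recursion. -/
def qBinom {k : Type*} [CommRing k] (q : k) : ℕ → ℕ → k
  | _, 0 => 1
  | 0, _ + 1 => 0
  | N + 1, i + 1 => qBinom q N i + q ^ (i + 1) * qBinom q N (i + 1)

theorem qBinom_eq_zero_of_lt {k : Type*} [CommRing k] (q : k) :
    ∀ (N i : ℕ), N < i → qBinom q N i = 0
  | _, 0, h => absurd h (Nat.not_lt_zero _)
  | 0, _ + 1, _ => rfl
  | N + 1, i + 1, h => by
    rw [qBinom, qBinom_eq_zero_of_lt q N i (by omega),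
      qBinom_eq_zero_of_lt q N (i + 1) (by omega)]
    simp

theorem qBinom_self {k : Type*} [CommRing k] (q : k) : ∀ N : ℕ, qBinom q N N = 1
  | 0 => rfl
  | N + 1 => by rw [qBinom, qBinom_self q N, qBinom_eq_zero_of_lt q N (N + 1) (by omega)]; simp

@[simp] theorem qBinom_zero_right {k : Type*} [CommRing k] (q : k) (N : ℕ) : qBinom q N 0 = 1 := by
  cases N <;> rfl

theorem one_sub_mul_qBinom {k : Type*} [CommRing k] (q : k) : ∀ (N i : ℕ),
    (1 - q ^ (i + 1)) * qBinom q (N + 1) (i + 1) = (1 - q ^ (N + 1)) * qBinom q N i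
  | 0, 0 => by simp [qBinom]
  | 0, i + 1 => by simp [qBinom]
  | N + 1, 0 => by
    have h := one_sub_mul_qBinom q N 0
    have h0 : qBinom q (N + 2) 1 = qBinom q (N + 1) 0 + q ^ 1 * qBinom q (N + 1) 1 := rfl
    simp only [qBinom_zero_right] at *
    linear_combination (1 - q) * h0 + q * h
  | N + 1, i + 1 => by
    have h := one_sub_mul_qBinom q N (i + 1)
    have h2 := one_sub_mul_qBinom q N i
    have h0 : qBinom q (N + 2) (i + 2)
        = qBinom q (N + 1) (i + 1) + q ^ (i + 2) * qBinom q (N + 1) (i + 2) := rfl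
    have h3 : qBinom q (N + 1) (i + 1) = qBinom q N i + q ^ (i + 1) * qBinom q N (i + 1) := rfl
    linear_combination (1 - q ^ (i + 2)) * h0 + q ^ (i + 2) * h + q * h2
      - q * (1 - q ^ (N + 1)) * h3

theorem add_pow_qBinom {k R : Type*} [CommRing k] [Ring R] [Algebra k R] (q : k) (a b : R)
    (h : b * a = q • (a * b)) (N : ℕ) :
    (a + b) ^ N = ∑ i ∈ Finset.range (N + 1), qBinom q N i • (a ^ i * b ^ (N - i)) := by
  have hb : ∀ i : ℕ, b * a ^ i = q ^ i • (a ^ i * b) := by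
    intro i
    induction i with
    | zero => simp
    | succ i ih =>
      rw [pow_succ, ← mul_assoc, ih, smul_mul_assoc, mul_assoc, h, mul_smul_comm, smul_smul,
        ← pow_succ, ← mul_assoc]
  induction N with
  | zero => simp
  | succ N ih =>
    rw [pow_succ', ih, add_mul, Finset.mul_sum, Finset.mul_sum,
      Finset.sum_range_succ' _ (N + 1)]
    have e : ∀ i ∈ Finset.range (N + 1), qBinom q (N + 1) (i + 1) • (a ^ (i + 1) * b ^ (N + 1 - (i + 1)))
        = a * (qBinom q N i • (a ^ i * b ^ (N - i)))
          + (q ^ (i + 1) * qBinom q N (i + 1)) • (a ^ (i + 1) * b ^ (N - i)) := by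
      intro i hi
      rw [qBinom, add_smul, Nat.add_sub_add_right, mul_smul_comm, ← mul_assoc, ← pow_succ']
    rw [Finset.sum_congr rfl e, Finset.sum_add_distrib, add_assoc]
    congr 1
    rw [Finset.sum_range_succ (fun i => (q ^ (i + 1) * qBinom q N (i + 1)) • (a ^ (i + 1) * b ^ (N - i))),
      Finset.sum_range_succ' (fun i => b * _)]
    rw [qBinom_eq_zero_of_lt q N (N + 1) (by omega)]
    simp only [mul_zero, zero_smul, add_zero, qBinom_zero_right, pow_zero, one_mul, one_smul,
      Nat.sub_zero, ← pow_succ']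
    congr 1
    refine Finset.sum_congr rfl fun i hi => ?_
    have hi := Finset.mem_range.1 hi
    rw [mul_smul_comm, ← mul_assoc, hb, smul_mul_assoc, mul_assoc, ← pow_succ', smul_smul, mul_comm]
    congr 4
    omega

theorem add_pow_of_isPrimitiveRoot {k R : Type*} [Field k] [Ring R] [Algebra k R] {q : k} {m : ℕ}
    (hm : m ≠ 0) (hq : IsPrimitiveRoot q m) (a b : R) (h : b * a = q • (a * b)) :
    (a + b) ^ m = a ^ m + b ^ m := by
  rw [add_pow_qBinom q a b h]
  obtain ⟨N, rfl⟩ := Nat.exists_eq_succ_of_ne_zero hm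
  rw [Finset.sum_range_succ, Finset.sum_range_succ', Finset.sum_eq_zero]
  · simp [qBinom_self, add_comm]
  · intro i hi
    have hi := Finset.mem_range.1 hi
    have h1 := one_sub_mul_qBinom q N i
    have h2 : q ^ (N + 1) = 1 := hq.pow_eq_one
    rw [h2, sub_self, zero_mul] at h1
    have h3 : (1 - q ^ (i + 1)) ≠ 0 :=
      sub_ne_zero.2 (hq.pow_ne_one_of_pos_of_lt (by omega) (by simpa using hi)).symm
    rw [(mul_eq_zero.1 h1).resolve_left h3, zero_smul]

theorem mul_pow_of_qcomm {k R : Type*} [CommRing k] [Ring R] [Algebra k R] (q : k) (a b : R)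
    (h : b * a = q • (a * b)) (N : ℕ) :
    (a * b) ^ N = q ^ (N * (N - 1) / 2) • (a ^ N * b ^ N) := by
  have hb : ∀ i : ℕ, b ^ i * a = q ^ i • (a * b ^ i) := by
    intro i
    induction i with
    | zero => simp
    | succ i ih =>
      rw [pow_succ', mul_assoc, ih, mul_smul_comm, ← mul_assoc, h, smul_mul_assoc, smul_smul,
        ← pow_succ, mul_assoc]
  induction N with
  | zero => simp
  | succ N ih =>
    have e : (N + 1) * (N + 1 - 1) / 2 = N * (N - 1) / 2 + N := by
      have := Nat.triangle_succ N
      rw [this]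
    rw [pow_succ, ih, smul_mul_assoc, mul_assoc, ← mul_assoc (b ^ N), hb, smul_mul_assoc,
      mul_smul_comm, smul_smul, ← pow_add, e, mul_assoc, ← pow_succ, ← mul_assoc, ← pow_succ]

theorem neg_one_pow_mul_pow_triangle {k : Type*} [Field k] {q : k} {m : ℕ}
    (hm : m ≠ 0) (hq : IsPrimitiveRoot q m) : (-1) ^ m * q ^ (m * (m - 1) / 2) = -1 := by
  rcases Nat.even_or_odd' m with ⟨r, rfl | rfl⟩
  · have h1 : (q ^ r) ^ 2 = 1 := by rw [← pow_mul, mul_comm, hq.pow_eq_one]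
    have h2 : q ^ r ≠ 1 := hq.pow_ne_one_of_pos_of_lt (by omega) (by omega)
    have h3 : q ^ r = -1 := (sq_eq_sq_iff_eq_or_eq_neg.1 (h1.trans (one_pow 2).symm)).resolve_left h2
    have e : 2 * r * (2 * r - 1) / 2 = r * (2 * r - 1) := by
      rw [mul_assoc, Nat.mul_div_cancel_left _ (by norm_num)]
    rw [e, pow_mul q, h3, pow_mul]
    have : Odd (2 * r - 1) := ⟨r - 1, by omega⟩
    simp [this.neg_one_pow]
  · have e : (2 * r + 1) * (2 * r + 1 - 1) / 2 = (2 * r + 1) * r := by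
      rw [Nat.add_sub_cancel, mul_comm 2 r, ← mul_assoc, Nat.mul_div_cancel _ (by norm_num)]
    rw [e, pow_mul, hq.pow_eq_one]
    simp [pow_add, pow_mul]

/-- The two generators of a generalized Taft algebra. -/
inductive TaftGen
  | x
  | g

/-- The relations `x ^ m = α (1 - g ^ m)`, `g ^ n = 1`, `g x = q x g`. -/
inductive TaftRel (n m : ℕ) (α q : ℂ) : FreeAlgebra ℂ TaftGen → FreeAlgebra ℂ TaftGen → Prop
  | x_pow : TaftRel n m α q (FreeAlgebra.ι ℂ TaftGen.x ^ m)
      (α • (1 - FreeAlgebra.ι ℂ TaftGen.g ^ m))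
  | g_pow : TaftRel n m α q (FreeAlgebra.ι ℂ TaftGen.g ^ n) 1
  | g_mul_x : TaftRel n m α q (FreeAlgebra.ι ℂ TaftGen.g * FreeAlgebra.ι ℂ TaftGen.x)
      (q • (FreeAlgebra.ι ℂ TaftGen.x * FreeAlgebra.ι ℂ TaftGen.g))

/-- The generalized Taft algebra `T(n, m, α)` at the primitive `m`-th root of unity `q`. -/
def GenTaft (n m : ℕ) (α : ℂ) {q : ℂ} (_hq : IsPrimitiveRoot q m) : Type :=
  RingQuot (TaftRel n m α q)

namespace GenTaft

variable {n m : ℕ} {α q : ℂ} {hq : IsPrimitiveRoot q m}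

instance : Ring (GenTaft n m α hq) := inferInstanceAs (Ring (RingQuot (TaftRel n m α q)))

instance : Algebra ℂ (GenTaft n m α hq) :=
  inferInstanceAs (Algebra ℂ (RingQuot (TaftRel n m α q)))

/-- The quotient map from the free algebra. -/
def mk (n m : ℕ) (α : ℂ) {q : ℂ} (hq : IsPrimitiveRoot q m) :
    FreeAlgebra ℂ TaftGen →ₐ[ℂ] GenTaft n m α hq :=
  RingQuot.mkAlgHom ℂ (TaftRel n m α q)

/-- The generator `x`. -/
def x (n m : ℕ) (α : ℂ) {q : ℂ} (hq : IsPrimitiveRoot q m) : GenTaft n m α hq :=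
  mk n m α hq (FreeAlgebra.ι ℂ TaftGen.x)

/-- The generator `g`. -/
def g (n m : ℕ) (α : ℂ) {q : ℂ} (hq : IsPrimitiveRoot q m) : GenTaft n m α hq :=
  mk n m α hq (FreeAlgebra.ι ℂ TaftGen.g)

theorem x_pow : x n m α hq ^ m = α • (1 - g n m α hq ^ m) := by
  have h := RingQuot.mkAlgHom_rel ℂ (TaftRel.x_pow (n := n) (m := m) (α := α) (q := q))
  rw [map_pow, map_smul, map_sub, map_pow, map_one] at h
  exact h

theorem g_pow : g n m α hq ^ n = 1 := by
  have h := RingQuot.mkAlgHom_rel ℂ (TaftRel.g_pow (n := n) (m := m) (α := α) (q := q))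
  rw [map_pow, map_one] at h
  exact h

theorem g_mul_x : g n m α hq * x n m α hq = q • (x n m α hq * g n m α hq) := by
  have h := RingQuot.mkAlgHom_rel ℂ (TaftRel.g_mul_x (n := n) (m := m) (α := α) (q := q))
  rw [map_mul, map_smul, map_mul] at h
  exact h

/-- The universal property of `T(n, m, α)`. -/
def lift {B : Type*} [Ring B] [Algebra ℂ B] (X G : B) (h₁ : X ^ m = α • (1 - G ^ m))
    (h₂ : G ^ n = 1) (h₃ : G * X = q • (X * G)) : GenTaft n m α hq →ₐ[ℂ] B :=
  RingQuot.liftAlgHom ℂ ⟨FreeAlgebra.lift ℂ (fun i => TaftGen.casesOn i X G), by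
    intro a b r
    cases r <;> simp [h₁, h₂, h₃]⟩

section lift

variable {B : Type*} [Ring B] [Algebra ℂ B] (X G : B) (h₁ : X ^ m = α • (1 - G ^ m))
    (h₂ : G ^ n = 1) (h₃ : G * X = q • (X * G))

@[simp] theorem lift_x : lift (hq := hq) X G h₁ h₂ h₃ (x n m α hq) = X := by
  unfold lift x mk
  erw [RingQuot.liftAlgHom_mkAlgHom_apply]
  simp

@[simp] theorem lift_g : lift (hq := hq) X G h₁ h₂ h₃ (g n m α hq) = G := by
  unfold lift g mk
  erw [RingQuot.liftAlgHom_mkAlgHom_apply]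
  simp

end lift

@[ext] theorem algHom_ext {B : Type*} [Semiring B] [Algebra ℂ B] {f f' : GenTaft n m α hq →ₐ[ℂ] B}
    (hx : f (x n m α hq) = f' (x n m α hq)) (hg : f (g n m α hq) = f' (g n m α hq)) : f = f' := by
  have h : f.comp (mk n m α hq) = f'.comp (mk n m α hq) := by
    refine FreeAlgebra.hom_ext (funext fun i => ?_)
    cases i
    · exact hx
    · exact hg
  refine AlgHom.ext fun a => ?_
  obtain ⟨b, rfl⟩ : ∃ b, mk n m α hq b = a := RingQuot.mkAlgHom_surjective ℂ _ a
  exact congrArg (fun F : FreeAlgebra ℂ TaftGen →ₐ[ℂ] B => F b) h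

theorem adjoin_eq_top : Algebra.adjoin ℂ {x n m α hq, g n m α hq} = ⊤ := by
  have h1 : (mk n m α hq).range = ⊤ :=
    (AlgHom.range_eq_top _).2 (RingQuot.mkAlgHom_surjective ℂ _)
  rw [← h1, ← Algebra.map_top, ← FreeAlgebra.adjoin_range_ι, AlgHom.map_adjoin]
  congr 1
  ext a
  constructor
  · rintro (rfl | rfl)
    · exact ⟨_, ⟨TaftGen.x, rfl⟩, rfl⟩
    · exact ⟨_, ⟨TaftGen.g, rfl⟩, rfl⟩
  · rintro ⟨_, ⟨i, rfl⟩, rfl⟩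
    cases i
    · exact Or.inl rfl
    · exact Or.inr rfl

theorem induction {P : GenTaft n m α hq → Prop} (h0 : ∀ r : ℂ, P (algebraMap ℂ _ r))
    (hx : P (x n m α hq)) (hg : P (g n m α hq)) (hadd : ∀ a b, P a → P b → P (a + b))
    (hmul : ∀ a b, P a → P b → P (a * b)) (a : GenTaft n m α hq) : P a := by
  have ha : a ∈ Algebra.adjoin ℂ {x n m α hq, g n m α hq} := by
    rw [adjoin_eq_top]; trivial
  refine Algebra.adjoin_induction (p := fun a _ => P a) ?_ h0 (fun a b _ _ => hadd a b)
    (fun a b _ _ => hmul a b) ha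
  rintro _ (rfl | rfl)
  · exact hx
  · exact hg

instance [NeZero n] : Module.Finite ℂ (GenTaft n m α hq) := by
  have hm : 0 < m ∨ m = 0 := (Nat.eq_zero_or_pos m).symm
  set S : Set (GenTaft n m α hq) :=
    Set.range fun p : Fin (m + 1) × Fin n => x n m α hq ^ (p.1 : ℕ) * g n m α hq ^ (p.2 : ℕ) with hS
  have hn : 0 < n := Nat.pos_of_ne_zero (NeZero.ne n)
  have gmod : ∀ j : ℕ, g n m α hq ^ j = g n m α hq ^ (j % n) := fun j => by
    conv_lhs => rw [← Nat.div_add_mod j n, pow_add, pow_mul, g_pow, one_pow, one_mul]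
  have key : ∀ i j : ℕ, i ≤ m → x n m α hq ^ i * g n m α hq ^ j ∈ Submodule.span ℂ S := by
    intro i j hi
    rw [gmod]
    exact Submodule.subset_span ⟨(⟨i, by omega⟩, ⟨j % n, Nat.mod_lt _ hn⟩), rfl⟩
  have hgx : ∀ i : ℕ, g n m α hq * x n m α hq ^ i = q ^ i • (x n m α hq ^ i * g n m α hq) := by
    intro i
    induction i with
    | zero => simp
    | succ i ih =>
      rw [pow_succ, ← mul_assoc, ih, smul_mul_assoc, mul_assoc, g_mul_x, mul_smul_comm, smul_smul,
        ← pow_succ, ← mul_assoc]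
  have hstep : ∀ a b : GenTaft n m α hq, b ∈ Submodule.span ℂ S → a * b ∈ Submodule.span ℂ S := by
    intro a
    induction a using induction with
    | h0 r => intro b hb; rw [← Algebra.smul_def]; exact Submodule.smul_mem _ _ hb
    | hadd a b ha hb => intro c hc; rw [add_mul]; exact add_mem (ha c hc) (hb c hc)
    | hmul a b ha hb => intro c hc; rw [mul_assoc]; exact ha _ (hb c hc)
    | hx =>
      intro b hb
      induction hb using Submodule.span_induction with
      | mem b hb =>
        obtain ⟨⟨i, j⟩, rfl⟩ := hb
        simp only
        rw [← mul_assoc, ← pow_succ']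
        rcases Nat.lt_or_ge (i : ℕ) m with h | h
        · exact key _ _ h
        · have hi : (i : ℕ) = m := by omega
          rw [hi, pow_succ', x_pow, mul_smul_comm, mul_sub, mul_one, smul_mul_assoc, sub_mul,
            mul_assoc, ← pow_add]
          rcases hm with hm | hm
          · refine Submodule.smul_mem _ _ (sub_mem ?_ ?_)
            · simpa using key 1 j hm
            · simpa using key 1 (m + j) hm
          · subst hm
            simp
      | zero => simp
      | add a b _ _ ha hb => rw [mul_add]; exact add_mem ha hb
      | smul r a _ ha => rw [mul_smul_comm]; exact Submodule.smul_mem _ _ ha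
    | hg =>
      intro b hb
      induction hb using Submodule.span_induction with
      | mem b hb =>
        obtain ⟨⟨i, j⟩, rfl⟩ := hb
        simp only
        rw [← mul_assoc, hgx, smul_mul_assoc, mul_assoc, ← pow_succ']
        exact Submodule.smul_mem _ _ (key _ _ (by omega))
      | zero => simp
      | add a b _ _ ha hb => rw [mul_add]; exact add_mem ha hb
      | smul r a _ ha => rw [mul_smul_comm]; exact Submodule.smul_mem _ _ ha
  refine ⟨(Submodule.fg_def.2 ⟨S, Set.finite_range _, eq_top_iff.2 fun a _ => ?_⟩)⟩
  have h1 : (1 : GenTaft n m α hq) ∈ Submodule.span ℂ S := by simpa using key 0 0 (Nat.zero_le _)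
  simpa using hstep a 1 h1

/-- The comultiplication, with `g` grouplike and `Δ x = x ⊗ 1 + g ⊗ x`. -/
def comulHom (n m : ℕ) [NeZero m] (α : ℂ) {q : ℂ} (hq : IsPrimitiveRoot q m) :
    GenTaft n m α hq →ₐ[ℂ] GenTaft n m α hq ⊗[ℂ] GenTaft n m α hq :=
  lift (x n m α hq ⊗ₜ 1 + g n m α hq ⊗ₜ x n m α hq) (g n m α hq ⊗ₜ g n m α hq)
    (by
      rw [add_pow_of_isPrimitiveRoot (NeZero.ne m) hq]
      · simp only [Algebra.TensorProduct.tmul_pow, one_pow, x_pow]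
        rw [← TensorProduct.smul_tmul', TensorProduct.tmul_smul, ← smul_add]
        congr 1
        rw [TensorProduct.sub_tmul, TensorProduct.tmul_sub, Algebra.TensorProduct.one_def]
        abel
      · simp only [Algebra.TensorProduct.tmul_mul_tmul, one_mul, mul_one]
        rw [g_mul_x, TensorProduct.smul_tmul'])
    (by simp only [Algebra.TensorProduct.tmul_pow, g_pow, Algebra.TensorProduct.one_def])
    (by
      simp only [mul_add, add_mul, Algebra.TensorProduct.tmul_mul_tmul, one_mul, mul_one, g_mul_x,
        smul_add, TensorProduct.smul_tmul', TensorProduct.tmul_smul])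

/-- The counit, with `ε g = 1` and `ε x = 0`. -/
def counitHom (n m : ℕ) [NeZero m] (α : ℂ) {q : ℂ} (hq : IsPrimitiveRoot q m) :
    GenTaft n m α hq →ₐ[ℂ] ℂ :=
  lift 0 1 (by simp [NeZero.ne m]) (by simp) (by simp)

instance [NeZero m] : Bialgebra ℂ (GenTaft n m α hq) :=
  Bialgebra.ofAlgHom (comulHom n m α hq) (counitHom n m α hq)
    (by
      ext
      · simp [comulHom, TensorProduct.tmul_add, TensorProduct.add_tmul,
          Algebra.TensorProduct.one_def, add_assoc]
      · simp [comulHom])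
    (by
      ext
      · simp [comulHom, counitHom]
      · simp [comulHom, counitHom])
    (by
      ext
      · simp [comulHom, counitHom]
      · simp [comulHom, counitHom])

theorem comul_x [NeZero m] : Coalgebra.comul (R := ℂ) (x n m α hq) =
    x n m α hq ⊗ₜ 1 + g n m α hq ⊗ₜ x n m α hq :=
  lift_x ..

theorem comul_g [NeZero m] : Coalgebra.comul (R := ℂ) (g n m α hq) = g n m α hq ⊗ₜ g n m α hq :=
  lift_g ..

theorem counit_x [NeZero m] : Coalgebra.counit (R := ℂ) (x n m α hq) = 0 := lift_x ..

theorem counit_g [NeZero m] : Coalgebra.counit (R := ℂ) (g n m α hq) = 1 := lift_g ..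

theorem g_mul_inv [NeZero n] : g n m α hq * g n m α hq ^ (n - 1) = 1 := by
  rw [← pow_succ', Nat.sub_add_cancel (Nat.pos_of_ne_zero (NeZero.ne n)), g_pow]

theorem inv_mul_g [NeZero n] : g n m α hq ^ (n - 1) * g n m α hq = 1 := by
  rw [← pow_succ, Nat.sub_add_cancel (Nat.pos_of_ne_zero (NeZero.ne n)), g_pow]

theorem x_mul_inv [NeZero n] : x n m α hq * g n m α hq ^ (n - 1) =
    q • (g n m α hq ^ (n - 1) * x n m α hq) := by
  calc x n m α hq * g n m α hq ^ (n - 1)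
      = g n m α hq ^ (n - 1) * (g n m α hq * x n m α hq) * g n m α hq ^ (n - 1) := by
        rw [← mul_assoc, inv_mul_g, one_mul]
    _ = _ := by
        rw [g_mul_x, mul_smul_comm, smul_mul_assoc, mul_assoc, mul_assoc, g_mul_inv, mul_one]

/-- The antipode as an anti-homomorphism: `S g = g⁻¹` and `S x = - g⁻¹ x`. -/
def antipodeHom (n m : ℕ) [NeZero n] [NeZero m] (α : ℂ) {q : ℂ} (hq : IsPrimitiveRoot q m) :
    GenTaft n m α hq →ₐ[ℂ] (GenTaft n m α hq)ᵐᵒᵖ :=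
  lift (MulOpposite.op (-(g n m α hq ^ (n - 1) * x n m α hq)))
    (MulOpposite.op (g n m α hq ^ (n - 1)))
    (by
      rw [← MulOpposite.op_pow, ← MulOpposite.op_pow, ← MulOpposite.op_one, ← MulOpposite.op_sub,
        ← MulOpposite.op_smul]
      congr 1
      have hg : (g n m α hq ^ (n - 1)) ^ m * g n m α hq ^ m = 1 := by
        rw [← (Commute.pow_left (Commute.refl _) _ : Commute (g n m α hq ^ (n - 1)) _).mul_pow,
          inv_mul_g, one_pow]
      rw [neg_pow, mul_pow_of_qcomm q _ _ x_mul_inv, mul_smul_comm, x_pow, mul_smul_comm,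
        mul_sub, mul_one, hg, mul_smul_comm, smul_smul]
      have h := neg_one_pow_mul_pow_triangle (NeZero.ne m) hq
      have h2 : ((-1 : GenTaft n m α hq) ^ m) = ((-1 : ℂ) ^ m) • 1 := by
        rw [Algebra.smul_def, mul_one, map_pow, map_neg, map_one]
      rw [h2, smul_mul_assoc, one_mul, smul_smul]
      have h3 : q ^ (m * (m - 1) / 2) * α * (-1) ^ m = - α := by linear_combination α * h
      rw [h3, neg_smul, ← smul_neg, neg_sub])
    (by
      rw [← MulOpposite.op_pow, ← pow_mul, mul_comm, pow_mul, g_pow, one_pow, MulOpposite.op_one])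
    (by
      rw [← MulOpposite.op_mul, ← MulOpposite.op_mul, ← MulOpposite.op_smul]
      congr 1
      rw [neg_mul, mul_neg, smul_neg, mul_assoc, x_mul_inv, mul_smul_comm])

theorem conv_mul_left {H : Type*} [Ring H] [Bialgebra ℂ H] (S : H →ₗ[ℂ] H)
    (hS : ∀ a b, S (a * b) = S b * S a) (a b : H)
    (ha : LinearMap.mul' ℂ H (S.rTensor H (Coalgebra.comul a)) = algebraMap ℂ H (Coalgebra.counit a))
    (hb : LinearMap.mul' ℂ H (S.rTensor H (Coalgebra.comul b)) = algebraMap ℂ H (Coalgebra.counit b)) :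
    LinearMap.mul' ℂ H (S.rTensor H (Coalgebra.comul (a * b))) =
      algebraMap ℂ H (Coalgebra.counit (a * b)) := by
  have key : ∀ u v : H ⊗[ℂ] H, LinearMap.mul' ℂ H (S.rTensor H u) ∈ (⊥ : Subalgebra ℂ H) →
      LinearMap.mul' ℂ H (S.rTensor H (u * v)) =
        LinearMap.mul' ℂ H (S.rTensor H u) * LinearMap.mul' ℂ H (S.rTensor H v) := by
    intro u v hu
    obtain ⟨r, hr⟩ := Algebra.mem_bot.1 hu
    rw [← hr]
    induction v with
    | zero => simp
    | add v w hv hw => simp only [mul_add, map_add, hv, hw]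
    | tmul c d =>
      have : LinearMap.mul' ℂ H (S.rTensor H (u * c ⊗ₜ d)) =
          S c * LinearMap.mul' ℂ H (S.rTensor H u) * d := by
        clear hu hr
        induction u with
        | zero => simp
        | add u w hu hw => simp only [add_mul, mul_add, map_add, hu, hw]
        | tmul e f => simp [hS, mul_assoc]
      rw [this, ← hr, LinearMap.rTensor_tmul, LinearMap.mul'_apply, ← Algebra.commutes, mul_assoc]
  rw [Bialgebra.comul_mul, key _ _ (ha ▸ Algebra.mem_bot.2 ⟨_, rfl⟩), ha, hb,
    Bialgebra.counit_mul, map_mul]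

theorem conv_mul_right {H : Type*} [Ring H] [Bialgebra ℂ H] (S : H →ₗ[ℂ] H)
    (hS : ∀ a b, S (a * b) = S b * S a) (a b : H)
    (ha : LinearMap.mul' ℂ H (S.lTensor H (Coalgebra.comul a)) = algebraMap ℂ H (Coalgebra.counit a))
    (hb : LinearMap.mul' ℂ H (S.lTensor H (Coalgebra.comul b)) = algebraMap ℂ H (Coalgebra.counit b)) :
    LinearMap.mul' ℂ H (S.lTensor H (Coalgebra.comul (a * b))) =
      algebraMap ℂ H (Coalgebra.counit (a * b)) := by
  have key : ∀ u v : H ⊗[ℂ] H, LinearMap.mul' ℂ H (S.lTensor H v) ∈ (⊥ : Subalgebra ℂ H) →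
      LinearMap.mul' ℂ H (S.lTensor H (u * v)) =
        LinearMap.mul' ℂ H (S.lTensor H u) * LinearMap.mul' ℂ H (S.lTensor H v) := by
    intro u v hv
    obtain ⟨r, hr⟩ := Algebra.mem_bot.1 hv
    rw [← hr]
    induction u with
    | zero => simp
    | add u w hu hw => simp only [add_mul, map_add, hu, hw]
    | tmul c d =>
      have : LinearMap.mul' ℂ H (S.lTensor H (c ⊗ₜ d * v)) =
          c * LinearMap.mul' ℂ H (S.lTensor H v) * S d := by
        clear hv hr
        induction v with
        | zero => simp
        | add u w hu hw => simp only [add_mul, mul_add, map_add, hu, hw]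
        | tmul e f => simp [hS, mul_assoc]
      rw [this, ← hr, LinearMap.lTensor_tmul, LinearMap.mul'_apply, mul_assoc, Algebra.commutes,
        ← mul_assoc]
  rw [Bialgebra.comul_mul, key _ _ (hb ▸ Algebra.mem_bot.2 ⟨_, rfl⟩), ha, hb,
    Bialgebra.counit_mul, map_mul]

/-- The antipode as a linear map. -/
def antipode (n m : ℕ) [NeZero n] [NeZero m] (α : ℂ) {q : ℂ} (hq : IsPrimitiveRoot q m) :
    GenTaft n m α hq →ₗ[ℂ] GenTaft n m α hq :=
  (MulOpposite.opLinearEquiv ℂ).symm.toLinearMap ∘ₗ (antipodeHom n m α hq).toLinearMap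

theorem antipode_mul [NeZero n] [NeZero m] (a b : GenTaft n m α hq) :
    antipode n m α hq (a * b) = antipode n m α hq b * antipode n m α hq a := by
  simp [antipode]

theorem antipode_algebraMap [NeZero n] [NeZero m] (r : ℂ) :
    antipode n m α hq (algebraMap ℂ _ r) = algebraMap ℂ _ r := by
  simp [antipode]

theorem antipode_x [NeZero n] [NeZero m] :
    antipode n m α hq (x n m α hq) = -(g n m α hq ^ (n - 1) * x n m α hq) := by
  simp [antipode, antipodeHom]

theorem antipode_g [NeZero n] [NeZero m] :
    antipode n m α hq (g n m α hq) = g n m α hq ^ (n - 1) := by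
  simp [antipode, antipodeHom]

instance [NeZero n] [NeZero m] : HopfAlgebra ℂ (GenTaft n m α hq) where
  antipode := antipode n m α hq
  mul_antipode_rTensor_comul := by
    refine LinearMap.ext fun a => ?_
    simp only [LinearMap.comp_apply, Algebra.linearMap_apply]
    induction a using induction with
    | h0 r => simp [Algebra.TensorProduct.algebraMap_apply, antipode_algebraMap]
    | hx =>
      have h1 : antipode n m α hq 1 = 1 := by simpa using antipode_algebraMap (hq := hq) 1
      simp [comul_x, counit_x, antipode_x, antipode_g]
    | hg => simp [comul_g, counit_g, antipode_g, inv_mul_g]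
    | hadd a b ha hb => simp only [map_add, ha, hb]
    | hmul a b ha hb => exact conv_mul_left _ antipode_mul a b ha hb
  mul_antipode_lTensor_comul := by
    refine LinearMap.ext fun a => ?_
    simp only [LinearMap.comp_apply, Algebra.linearMap_apply]
    induction a using induction with
    | h0 r =>
      have h1 : antipode n m α hq 1 = 1 := by simpa using antipode_algebraMap (hq := hq) 1
      simp [Algebra.TensorProduct.algebraMap_apply, h1]
    | hx =>
      have h1 : antipode n m α hq 1 = 1 := by simpa using antipode_algebraMap (hq := hq) 1
      simp [comul_x, counit_x, antipode_x, h1, ← mul_assoc, g_mul_inv]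
    | hg => simp [comul_g, counit_g, antipode_g, g_mul_inv]
    | hadd a b ha hb => simp only [map_add, ha, hb]
    | hmul a b ha hb => exact conv_mul_right _ antipode_mul a b ha hb

end GenTaft

/-! ### Actions of Hopf algebras -/

/-- An action of a Hopf algebra `H` on an algebra `A`, i.e. an `H`-module algebra structure on `A`:
an `H`-module structure such that `h · 1 = ε(h) 1` and `h · (ab) = ∑ (h₁ · a) (h₂ · b)`. -/
structure HopfAction (k H A : Type*) [Field k] [Ring H] [HopfAlgebra k H] [Ring A]
    [Algebra k A] where
  /-- The underlying representation of the algebra `H` on the vector space `A`. -/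
  act : H →ₐ[k] Module.End k A
  act_one : ∀ h : H, act h 1 = algebraMap k A (Coalgebra.counit h)
  act_mul : ∀ (h : H) (a b : A), act h (a * b) =
    LinearMap.mul' k A (TensorProduct.map (act.toLinearMap.flip a) (act.toLinearMap.flip b)
      (Coalgebra.comul h))

namespace HopfAction

universe u

variable {k A : Type*} {H : Type u} [Field k] [Ring H] [HopfAlgebra k H] [Ring A] [Algebra k A]
  (ρ : HopfAction k H A)

/-- An action is inner faithful if it factors through no proper Hopf quotient of `H`: every
surjective map of Hopf algebras `π : H → K` through which `H → End(A)` factors is injective. -/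
def IsInnerFaithful : Prop :=
  ∀ (K : Type u) [Ring K] [HopfAlgebra k K] (π : H →ₐc[k] K), Function.Surjective π →
    (∃ τ : K →ₐ[k] Module.End k A, ∀ h : H, ρ.act h = τ (π h)) → Function.Injective π

theorem act_mul_of_mem {b : A} (hb : ∀ h : H, ρ.act h b = (Coalgebra.counit h : k) • b) (h : H)
    (c : A) : ρ.act h (b * c) = b * ρ.act h c := by
  have e : ρ.act.toLinearMap.flip b =
      (LinearMap.toSpanSingleton k A b) ∘ₗ (Coalgebra.counit (R := k) (A := H)) := by
    ext h'
    simp [hb]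
  have key : ∀ u : H ⊗[k] H, LinearMap.mul' k A (TensorProduct.map
      ((LinearMap.toSpanSingleton k A b) ∘ₗ (Coalgebra.counit (R := k) (A := H)))
      (ρ.act.toLinearMap.flip c) u) =
      b * ρ.act (TensorProduct.lid k H (Coalgebra.counit.rTensor H u)) c := by
    intro u
    induction u with
    | zero => simp
    | add u v hu hv => simp only [map_add, hu, hv, mul_add, LinearMap.add_apply]
    | tmul u v => simp
  rw [ρ.act_mul, e, key, Coalgebra.rTensor_counit_comul]
  simp

/-- The subalgebra of invariants `A ^ H = {a | h · a = ε(h) a for all h}`. -/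
def invariants : Subalgebra k A where
  carrier := {a | ∀ h : H, ρ.act h a = (Coalgebra.counit h : k) • a}
  mul_mem' := fun {a b} ha hb h => by
    rw [ρ.act_mul_of_mem ha, hb h, mul_smul_comm]
  add_mem' := fun {a b} ha hb h => by rw [map_add, ha h, hb h, smul_add]
  algebraMap_mem' := fun r h => by
    rw [Algebra.algebraMap_eq_smul_one, map_smul, ρ.act_one, Algebra.algebraMap_eq_smul_one,
      smul_comm]

/-- The right `H*`-coaction `A → A ⊗ H*` corresponding to the action of a finite-dimensional `H`:
it sends `a` to the tensor `∑ aᵢ ⊗ fᵢ` with `∑ fᵢ(h) aᵢ = h · a` for all `h`. -/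
def coaction [Module.Finite k H] : A →ₗ[k] A ⊗[k] Module.Dual k H :=
  (TensorProduct.comm k (Module.Dual k H) A).toLinearMap ∘ₗ
    (dualTensorHomEquiv k H A).symm.toLinearMap ∘ₗ ρ.act.toLinearMap.flip

/-- The subspace of `A ⊗ A` spanned by all `ab ⊗ c - a ⊗ bc` with `b` in the subalgebra `B`. -/
def balancing (B : Subalgebra k A) : Submodule k (A ⊗[k] A) :=
  Submodule.span k {u | ∃ a b c : A, b ∈ B ∧ u = (a * b) ⊗ₜ[k] c - a ⊗ₜ[k] (b * c)}

/-- The tensor product `A ⊗_B A` over a (possibly noncommutative) subalgebra `B`. -/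
abbrev RelTensor (B : Subalgebra k A) : Type _ := (A ⊗[k] A) ⧸ balancing B

/-- The map `A ⊗ A → A ⊗ H*`, `a ⊗ b ↦ (a ⊗ 1) δ(b)`, where `δ` is the coaction. -/
def preGaloisMap [Module.Finite k H] : A ⊗[k] A →ₗ[k] A ⊗[k] Module.Dual k H :=
  TensorProduct.lift
    ((LinearMap.llcomp k A (A ⊗[k] Module.Dual k H) (A ⊗[k] Module.Dual k H)).flip ρ.coaction ∘ₗ
      (LinearMap.rTensorHom (Module.Dual k H) ∘ₗ LinearMap.mul k A))

theorem preGaloisMap_tmul [Module.Finite k H] (a b : A) :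
    ρ.preGaloisMap (a ⊗ₜ b) = (LinearMap.mulLeft k a).rTensor (Module.Dual k H) (ρ.coaction b) :=
  rfl

theorem coaction_mul_of_mem [Module.Finite k H] {b : A} (hb : b ∈ ρ.invariants) (c : A) :
    ρ.coaction (b * c) = (LinearMap.mulLeft k b).rTensor (Module.Dual k H) (ρ.coaction c) := by
  have key : ∀ u : Module.Dual k H ⊗[k] A, dualTensorHom k H A
      ((LinearMap.mulLeft k b).lTensor (Module.Dual k H) u) =
        LinearMap.mulLeft k b ∘ₗ dualTensorHom k H A u := by
    intro u
    induction u with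
    | zero => simp
    | add u v hu hv => simp only [map_add, hu, hv, LinearMap.comp_add]
    | tmul f a => ext h; simp
  have e : (dualTensorHomEquiv k H A).symm (ρ.act.toLinearMap.flip (b * c)) =
      (LinearMap.mulLeft k b).lTensor (Module.Dual k H)
        ((dualTensorHomEquiv k H A).symm (ρ.act.toLinearMap.flip c)) := by
    rw [LinearEquiv.symm_apply_eq]
    have h2 : ∀ u, dualTensorHomEquiv k H A u = dualTensorHom k H A u := fun u => rfl
    rw [h2, key, ← h2, LinearEquiv.apply_symm_apply]
    ext h
    simpa using ρ.act_mul_of_mem hb h c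
  simp only [coaction, LinearMap.comp_apply, LinearEquiv.coe_coe, e]
  generalize (dualTensorHomEquiv k H A).symm (ρ.act.toLinearMap.flip c) = u
  induction u with
  | zero => simp
  | add u v hu hv => simp only [map_add, hu, hv]
  | tmul f a => simp

/-- The canonical Galois map `A ⊗_{A^H} A → A ⊗ H*`, `a ⊗ b ↦ (a ⊗ 1) δ(b)`. -/
def galoisMap [Module.Finite k H] : RelTensor ρ.invariants →ₗ[k] A ⊗[k] Module.Dual k H :=
  (balancing ρ.invariants).liftQ ρ.preGaloisMap (Submodule.span_le.2 (by
    rintro _ ⟨a, b, c, hb, rfl⟩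
    rw [SetLike.mem_coe, LinearMap.mem_ker, map_sub, preGaloisMap_tmul, preGaloisMap_tmul,
      ρ.coaction_mul_of_mem hb, sub_eq_zero, LinearMap.mulLeft_mul, LinearMap.rTensor_comp]
    rfl))

/-- The action is Hopf-Galois (`A` is `H`-Galois over `A ^ H`) if the Galois map of the
corresponding `H*`-coaction is bijective. -/
def IsHopfGalois [Module.Finite k H] : Prop := Function.Bijective ρ.galoisMap

end HopfAction

/-! ### Ore extensions -/

section Ore

variable {k L : Type*} [Field k] [Field L] [Algebra k L]

/-- A copy of the field `L` on which `ℕ` acts by the powers of `σ⁻¹`. -/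
def SkewCoeff (_σ : L ≃ₐ[k] L) : Type _ := L

namespace SkewCoeff

variable (σ : L ≃ₐ[k] L)

instance : Field (SkewCoeff σ) := inferInstanceAs (Field L)

instance : Algebra k (SkewCoeff σ) := inferInstanceAs (Algebra k L)

/-- The identification of `L` with its copy. -/
def of : L ≃ₐ[k] SkewCoeff σ := AlgEquiv.refl (R := k) (A₁ := L)

/-- The automorphism `σ` of the copy of `L`. -/
def aut : SkewCoeff σ ≃ₐ[k] SkewCoeff σ := ((of σ).symm.trans σ).trans (of σ)

instance : MulSemiringAction (Multiplicative ℕ) (SkewCoeff σ) :=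
  MulSemiringAction.compHom (SkewCoeff σ) (powersHom (SkewCoeff σ ≃ₐ[k] SkewCoeff σ) (aut σ)⁻¹)

theorem smul_def (i : Multiplicative ℕ) (a : SkewCoeff σ) :
    i • a = ((aut σ)⁻¹ ^ i.toAdd) a := rfl

instance : SMulCommClass (Multiplicative ℕ) k (SkewCoeff σ) :=
  ⟨fun i r a => by simp only [smul_def, map_smul]⟩

end SkewCoeff

/-- The Ore extension `L[t; σ]`, with relation `a t = t σ(a)`, i.e. `t a = σ⁻¹(a) t`: Mathlib's ring
of skew polynomials for the action of `ℕ` on `L` by powers of `σ⁻¹`. -/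
abbrev OreExt (σ : L ≃ₐ[k] L) : Type _ := SkewPolynomial (SkewCoeff σ)

namespace OreExt

variable (σ : L ≃ₐ[k] L)

/-- The inclusion of the coefficient field. -/
def C : L →+* OreExt σ := SkewPolynomial.CRingHom.comp (SkewCoeff.of σ : L →+* SkewCoeff σ)

/-- The indeterminate. -/
def t : OreExt σ := SkewPolynomial.X

theorem C_mul_t (a : L) : C σ a * t σ = t σ * C σ (σ a) := by
  have h : (SkewPolynomial.φ : SkewCoeff σ →+* SkewCoeff σ) (SkewCoeff.of σ (σ a)) =
      SkewCoeff.of σ a := by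
    change (Multiplicative.ofAdd 1) • (SkewCoeff.of σ (σ a)) = _
    rw [SkewCoeff.smul_def, toAdd_ofAdd, pow_one, AlgEquiv.aut_inv, AlgEquiv.symm_apply_eq]
    simp [SkewCoeff.aut]
  change SkewPolynomial.CRingHom (SkewCoeff.of σ a) * SkewPolynomial.X =
    SkewPolynomial.X * SkewPolynomial.CRingHom (SkewCoeff.of σ (σ a))
  rw [SkewPolynomial.CRingHom_eq_C, SkewPolynomial.CRingHom_eq_C,
    ← SkewPolynomial.monomial_zero_left, ← SkewPolynomial.monomial_zero_left,
    SkewPolynomial.X_mul_monomial, SkewPolynomial.monomial_mul_X, h]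

theorem algebraMap_eq (r : k) : algebraMap k (OreExt σ) r = C σ (algebraMap k L r) := rfl

end OreExt

end Ore

/-! ### Central localizations -/

section CenterLoc

variable (A : Type*) [Ring A]

/-- The monoid of central elements which are not zero divisors; for a domain, these are the nonzero
central elements. -/
def centralRegular : Submonoid A := Submonoid.center A ⊓ nonZeroDivisors A

instance : OreLocalization.OreSet (centralRegular A) where
  ore_right_cancel r₁ r₂ s h := ⟨s, by
    have h1 := Submonoid.mem_center_iff.1 s.2.1
    rw [← h1, ← h1, h]⟩
  oreNum r _ := r
  oreDenom _ s := s
  ore_eq r s := (Submonoid.mem_center_iff.1 s.2.1 r).symm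

/-- The ring of fractions `Frac(A) = Frac(Z(A)) ⊗_{Z(A)} A` of a domain `A` that is finite over its
center, i.e. the localization of `A` at its nonzero central elements. -/
abbrev CenterFrac : Type _ := OreLocalization (centralRegular A) A

end CenterLoc

/-! ### The division algebra -/

section TaftDivision

/-- The polynomial `(X ^ m - 1) ^ (n / m) - w` over `ℂ(w)`. -/
def taftPoly (n m : ℕ) : Polynomial (RatFunc ℂ) :=
  (Polynomial.X ^ m - 1) ^ (n / m) - Polynomial.C RatFunc.X

variable {L : Type*} [Field L] [Algebra (RatFunc ℂ) L] [Algebra ℂ L]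
  [IsScalarTower ℂ (RatFunc ℂ) L]

/-- With `s = n / m`: an `s`-th root `y` of `w` in `L`, together with solutions `c j ∈ L` of
`X ^ m - ζ ^ (j m) y - 1 = 0` for `j` in `ℤ / s`. -/
structure IsRootSystem (n m : ℕ) (ζ : ℂ) (y : L) (c : ZMod (n / m) → L) : Prop where
  root_pow : y ^ (n / m) = algebraMap (RatFunc ℂ) L RatFunc.X
  eq_zero : ∀ j, c j ^ m - algebraMap ℂ L (ζ ^ (j.val * m)) * y - 1 = 0

/-- `Q = Frac(L[t; σ])`. -/
abbrev TaftQ (σ : L ≃ₐ[RatFunc ℂ] L) : Type _ := CenterFrac (OreExt (σ.restrictScalars ℂ))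

/-- The inclusion of `L` in `Q`. -/
def TaftQ.C (σ : L ≃ₐ[RatFunc ℂ] L) : L →+* TaftQ σ :=
  OreLocalization.numeratorRingHom.comp (OreExt.C (σ.restrictScalars ℂ))

/-- The element `t` of `Q`. -/
def TaftQ.t (σ : L ≃ₐ[RatFunc ℂ] L) : TaftQ σ :=
  OreLocalization.numeratorRingHom (OreExt.t (σ.restrictScalars ℂ))

end TaftDivision

end

/-! Write s = n/m and ξ = ζ^m, a primitive s-th root of 1. Since w = y^s, the field ℂ(w)(y) is the
rational function field ℂ(y), and c_j^m = ξ^j y + 1. These linear polynomials have distinct roots,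
so by Kummer theory (`exists_algEquiv_of_independent_roots`) automorphisms can multiply the c_j
independently by m-th roots of 1. Correcting a lift of y ↦ ξ y in this way gives the shift σ. It is
unique because every root of the splitting polynomial is a power of q times some c_j, and σ^s = 1.
Hence L[t; σ] is finite over its center, which contains ℂ(w) and t^s, and inverting the nonzero
central elements inverts every nonzero element.

The action rests on one identity. Let γ be the automorphism of Q with c_j ↦ q c_j and t ↦ ζ t. Then
γ^m is trivial on L and multiplies t by ξ, and so does conjugation by y, because y t = t σ(y) = ξ t
y. Thus y a = γ^m(a) y for all a, whence c_i^m a - γ^m(a) c_i^m = a - γ^m(a). The operators a ↦ c_i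
a and a ↦ -γ(a) c_i q-commute, so the m-th power of their sum is the sum of their m-th powers, and
x^m = α(1 - g^m) follows (`GenTaft.exists_hopfAction`).

If γ(a) = a, the same identity says that a commutes with y. For an element of L[t; σ] this forces
the coefficient of t^l to vanish unless σ^l fixes y, that is, unless s divides l; so a commutes with
all of L, in particular with c_i, and x kills it. The invariants are therefore the fixed ring of γ,
over which 1, t, …, t^(n-1) is a basis by the decomposition into eigenspaces
(`exists_basis_pow_of_eigenvector`). The rank is n = sm, while Q ⊗ T* has rank nm over Q, too large
for the Galois map to be onto when m ≥ 2.

Inner faithfulness and dim T = nm have a common source,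
`linearIndependent_skewPrimitive_mul_groupLike`: in any bialgebra the elements X^i G^j are
independent once the powers of G are distinct and X ≠ 0. Both conditions are visible on Q: g^j
multiplies t by ζ^j, and x · c_i = β(1 - q) c_i² ≠ 0 if m ≥ 2. -/

noncomputable section

/-! ### Kummer theory for several independent radicals -/

section Kummer

open Polynomial

/-- If the number of distinct characters of `G` that factor through `κ : G → M` is at least the
cardinality of `M`, then `κ` is surjective. -/
theorem surjective_of_card_le_characters {G M ι L : Type*} [Monoid G] [Field L] [Fintype M]
    [Fintype ι] (κ : G → M) (χ : ι → G →* L) (hχ : Function.Injective χ) (F : ι → M → L)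
    (hF : ∀ i τ, F i (κ τ) = χ i τ) (hcard : Fintype.card M ≤ Fintype.card ι) :
    Function.Surjective κ := by
  classical
  have h1 : LinearIndependent L (fun i => (χ i : G → L)) :=
    (linearIndependent_monoidHom G L).comp χ hχ
  let Φ : (Set.range κ → L) →ₗ[L] (G → L) :=
    LinearMap.funLeft L L (fun τ => (⟨κ τ, τ, rfl⟩ : Set.range κ))
  -- The characters are pulled back from functions on the image of `κ`. By Dedekind's independence
  -- of characters those functions are independent, so the image has at least as many points as
  -- there are characters.
  have h2 : LinearIndependent L (fun i => fun p : Set.range κ => F i p) := by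
    refine LinearIndependent.of_comp Φ ?_
    convert h1 using 1
    funext i τ
    exact hF i τ
  have h3 := h2.fintype_card_le_finrank
  rw [Module.finrank_fintype_fun_eq_card] at h3
  have h4 : Fintype.card (Set.range κ) = Fintype.card M :=
    le_antisymm (Fintype.card_le_of_injective _ Subtype.val_injective) (hcard.trans h3)
  exact Set.range_eq_univ.1 ((set_fintype_card_eq_univ_iff _).1 h4)

/-- The character through which automorphisms act on a common eigenvector. -/
def eigenCharacter {F L : Type*} [Field F] [Field L] [Algebra F L] (v : L) (hv : v ≠ 0)
    (h : ∀ τ : L ≃ₐ[F] L, ∃ r : F, τ v = algebraMap F L r * v) : (L ≃ₐ[F] L) →* L where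
  toFun τ := τ v / v
  map_one' := by simp [hv]
  map_mul' τ τ' := by
    obtain ⟨r, hr⟩ := h τ
    obtain ⟨r', hr'⟩ := h τ'
    rw [AlgEquiv.mul_apply, hr', map_mul, AlgEquiv.commutes, hr]
    field_simp

/-- Kummer theory: automorphisms multiply independent `m`-th roots by arbitrary roots of unity. -/
theorem exists_algEquiv_of_independent_roots {F L ι : Type*} [Field F] [Field L] [Algebra F L]
    [FiniteDimensional F L] [IsGalois F L] [Fintype ι] (m : ℕ) [NeZero m] (q : F)
    (hq : IsPrimitiveRoot q m) (c : ι → L) (hc : ∀ i, c i ≠ 0)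
    (hpow : ∀ i, ∃ a : F, c i ^ m = algebraMap F L a)
    (hind : ∀ e e' : ι → Fin m, ∀ h : F,
      ∏ i, c i ^ (e i : ℕ) = algebraMap F L h * ∏ i, c i ^ (e' i : ℕ) → e = e')
    (e : ι → Fin m) :
    ∃ τ : L ≃ₐ[F] L, ∀ i, τ (c i) = algebraMap F L (q ^ (e i : ℕ)) * c i := by
  classical
  have hqL : IsPrimitiveRoot (algebraMap F L q) m :=
    hq.map_of_injective (algebraMap F L).injective
  have hex : ∀ (τ : L ≃ₐ[F] L) (i : ι), ∃ k : Fin m, τ (c i) = algebraMap F L (q ^ (k : ℕ)) * c i := by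
    intro τ i
    obtain ⟨a, ha⟩ := hpow i
    have h1 : (τ (c i) / c i) ^ m = 1 := by
      rw [div_pow, ← map_pow, ha, AlgEquiv.commutes, div_self]
      rw [← ha]; exact pow_ne_zero _ (hc i)
    obtain ⟨k, hk, hk'⟩ := hqL.eq_pow_of_pow_eq_one h1
    exact ⟨⟨k, hk⟩, by rw [map_pow, hk', div_mul_cancel₀ _ (hc i)]⟩
  choose κ hκ using hex
  have hv : ∀ e : ι → Fin m, ∏ i, c i ^ (e i : ℕ) ≠ 0 := fun e =>
    Finset.prod_ne_zero_iff.2 fun i _ => pow_ne_zero _ (hc i)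
  have hact : ∀ (e : ι → Fin m) (τ : L ≃ₐ[F] L), τ (∏ i, c i ^ (e i : ℕ)) =
      algebraMap F L (∏ i, (q ^ (κ τ i : ℕ)) ^ (e i : ℕ)) * ∏ i, c i ^ (e i : ℕ) := by
    intro e τ
    rw [map_prod, map_prod, ← Finset.prod_mul_distrib]
    refine Finset.prod_congr rfl fun i _ => ?_
    rw [map_pow, hκ, mul_pow, map_pow _ _ (e i : ℕ)]
  let χ : (ι → Fin m) → (L ≃ₐ[F] L) →* L := fun e =>
    eigenCharacter _ (hv e) fun τ => ⟨_, hact e τ⟩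
  have hχ : Function.Injective χ := by
    intro e e' hee
    -- Monomials with the same character have a Galois-invariant quotient, which then lies in `F`;
    -- this is what `hind` excludes.
    have hfix : ∀ τ : L ≃ₐ[F] L, τ ((∏ i, c i ^ (e i : ℕ)) / ∏ i, c i ^ (e' i : ℕ)) =
        (∏ i, c i ^ (e i : ℕ)) / ∏ i, c i ^ (e' i : ℕ) := by
      intro τ
      have h1 : τ (∏ i, c i ^ (e i : ℕ)) / (∏ i, c i ^ (e i : ℕ)) =
        τ (∏ i, c i ^ (e' i : ℕ)) / (∏ i, c i ^ (e' i : ℕ)) := DFunLike.congr_fun hee τ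
      have h2 : τ (∏ i, c i ^ (e' i : ℕ)) ≠ 0 := (map_ne_zero τ).2 (hv e')
      rw [map_div₀]
      rw [div_eq_div_iff (hv e) (hv e')] at h1
      rw [div_eq_div_iff h2 (hv e'), h1, mul_comm]
    obtain ⟨h, hh⟩ := (IsGalois.mem_range_algebraMap_iff_fixed _).2 hfix
    exact hind e e' h (by rw [hh, div_mul_cancel₀ _ (hv e')])
  obtain ⟨τ, hτ⟩ := surjective_of_card_le_characters κ χ hχ
    (fun e k => algebraMap F L (∏ i, (q ^ (k i : ℕ)) ^ (e i : ℕ)))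
    (fun e τ => by
      change _ = τ (∏ i, c i ^ (e i : ℕ)) / (∏ i, c i ^ (e i : ℕ))
      rw [hact, mul_div_cancel_right₀ _ (hv e)]) le_rfl e
  exact ⟨τ, fun i => by rw [hκ, hτ]⟩

end Kummer

/-! ### The field L, the roots c_j and the shift automorphism σ -/

section RootSystem

open Polynomial

/-- On either side the multiplicity of the root -1/u_j is congruent modulo m to the j-th exponent,
since an m-th power contributes a multiple of m. Exponents below m are thus determined. -/
theorem Polynomial.exponents_eq_of_prod_linear {k ι : Type*} [Field k] [Fintype ι] {m : ℕ}
    (u : ι → k) (hu : Function.Injective u) (hu0 : ∀ i, u i ≠ 0) (P Q : k[X]) (hP : P ≠ 0)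
    (hQ : Q ≠ 0) (e e' : ι → Fin m)
    (h : Q ^ m * ∏ i, (C (u i) * X + C 1) ^ (e i : ℕ) =
      P ^ m * ∏ i, (C (u i) * X + C 1) ^ (e' i : ℕ)) : e = e' := by
  classical
  have hne : ∀ i, C (u i) * X + C 1 ≠ 0 := fun i h0 => by
    have := congrArg (fun p => Polynomial.coeff p 1) h0
    simp [hu0 i, coeff_one] at this
  have hprod : ∀ e : ι → Fin m, ∏ i, (C (u i) * X + C 1) ^ (e i : ℕ) ≠ 0 := fun e =>
    Finset.prod_ne_zero_iff.2 fun i _ => pow_ne_zero _ (hne i)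
  have hcount : ∀ (R : k[X]), R ≠ 0 → ∀ (e : ι → Fin m) (j : ι),
      (R ^ m * ∏ i, (C (u i) * X + C 1) ^ (e i : ℕ)).roots.count (-(u j)⁻¹) =
        m * R.roots.count (-(u j)⁻¹) + e j := by
    intro R hR e j
    rw [roots_mul (mul_ne_zero (pow_ne_zero _ hR) (hprod e)), Multiset.count_add, roots_pow,
      Multiset.count_nsmul, roots_prod _ _ (hprod e), Multiset.count_bind]
    congr 1
    rw [← Finset.sum_eq_multiset_sum, Finset.sum_eq_single j]
    · rw [roots_pow, Multiset.count_nsmul, roots_C_mul_X_add_C _ (hu0 j)]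
      simp
    · intro i _ hij
      rw [roots_pow, Multiset.count_nsmul, roots_C_mul_X_add_C _ (hu0 i), mul_one,
        Multiset.count_singleton, if_neg, mul_zero]
      intro h'
      exact hij (hu (inv_injective (neg_injective h'))).symm
    · simp
  funext j
  have h1 := hcount Q hQ e j
  rw [h, hcount P hP e' j] at h1
  have h2 := congrArg (· % m) h1
  simp only [Nat.mul_add_mod, Nat.mod_eq_of_lt (e j).2, Nat.mod_eq_of_lt (e' j).2] at h2
  exact Fin.ext h2.symm

variable {L : Type*} [Field L] [Algebra (RatFunc ℂ) L] [Algebra ℂ L]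
  [IsScalarTower ℂ (RatFunc ℂ) L]

theorem transcendental_of_pow_eq_X {s : ℕ} {y : L}
    (hy : y ^ s = algebraMap (RatFunc ℂ) L RatFunc.X) : Transcendental ℂ y := by
  intro h
  have h1 : IsAlgebraic ℂ (algebraMap (RatFunc ℂ) L RatFunc.X) := hy ▸ h.pow s
  rw [isAlgebraic_algebraMap_iff (algebraMap (RatFunc ℂ) L).injective] at h1
  exact RatFunc.transcendental_X h1

/-- Since w = y^s is a polynomial in y, adjoining y to ℂ(w) gives nothing beyond ℂ(y). -/
theorem exists_polynomial_fraction {s : ℕ} {y : L}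
    (hy : y ^ s = algebraMap (RatFunc ℂ) L RatFunc.X) (x : L)
    (hx : x ∈ IntermediateField.adjoin (RatFunc ℂ) {y}) :
    ∃ P Q : ℂ[X], x = aeval y P / aeval y Q := by
  rw [← IntermediateField.mem_adjoin_simple_iff]
  induction hx using IntermediateField.adjoin_induction with
  | mem x hx => exact IntermediateField.subset_adjoin _ _ hx
  | algebraMap f =>
    have hp : ∀ p : ℂ[X], algebraMap (RatFunc ℂ) L (algebraMap ℂ[X] (RatFunc ℂ) p) ∈
        IntermediateField.adjoin ℂ {y} := by
      intro p
      rw [← RatFunc.aeval_X_left_eq_algebraMap, ← aeval_algebraMap_apply, ← hy]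
      refine Algebra.adjoin_le (S := (IntermediateField.adjoin ℂ {y}).toSubalgebra) ?_
        (aeval_mem_adjoin_singleton ℂ (y ^ s) (p := p))
      rintro _ rfl
      exact pow_mem (IntermediateField.mem_adjoin_simple_self ℂ y) s
    rw [← RatFunc.num_div_denom f, map_div₀]
    exact div_mem (hp _) (hp _)
  | add a b _ _ ha hb => exact add_mem ha hb
  | inv a _ ha => exact inv_mem ha
  | mul a b _ _ ha hb => exact mul_mem ha hb

theorem RatFunc.intDegree_pow_of_ne_zero {k : Type*} [Field k] {f : RatFunc k} (hf : f ≠ 0)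
    (s : ℕ) : (f ^ s).intDegree = s * f.intDegree := by
  induction s with
  | zero => simp
  | succ s ih =>
    rw [pow_succ, RatFunc.intDegree_mul (pow_ne_zero _ hf) hf, ih]
    push_cast
    ring

/-- Kummer theory for the single radical y. Distinct powers y^a with a < s are independent modulo
ℂ(w), because the degree in w of h^s w^a is a modulo s. -/
theorem exists_algEquiv_mul_root [FiniteDimensional (RatFunc ℂ) L] [IsGalois (RatFunc ℂ) L]
    {s : ℕ} [NeZero s] {ξ : ℂ} (hξ : IsPrimitiveRoot ξ s) {y : L}
    (hy : y ^ s = algebraMap (RatFunc ℂ) L RatFunc.X) :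
    ∃ τ : L ≃ₐ[RatFunc ℂ] L, τ y = algebraMap ℂ L ξ * y := by
  have hX : (RatFunc.X : RatFunc ℂ) ≠ 0 := RatFunc.X_ne_zero
  have hy0 : y ≠ 0 := by
    rintro rfl
    rw [zero_pow (NeZero.ne s)] at hy
    exact hX ((map_eq_zero _).1 hy.symm)
  have key : ∀ e : Fin s, ∃ τ : L ≃ₐ[RatFunc ℂ] L,
      τ y = algebraMap _ L (algebraMap ℂ (RatFunc ℂ) ξ ^ (e : ℕ)) * y := by
    intro e
    obtain ⟨τ, hτ⟩ := exists_algEquiv_of_independent_roots (F := RatFunc ℂ) (ι := Unit) s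
      (algebraMap ℂ (RatFunc ℂ) ξ) (hξ.map_of_injective (algebraMap ℂ (RatFunc ℂ)).injective)
      (fun _ => y) (fun _ => hy0) (fun _ => ⟨_, hy⟩) (by
        intro a b h hab
        simp only [Finset.univ_unique, Finset.prod_singleton] at hab
        have h0 : h ≠ 0 := by
          rintro rfl
          rw [map_zero, zero_mul] at hab
          exact pow_ne_zero _ hy0 hab
        have h1 := congrArg (· ^ s) hab
        simp only [mul_pow] at h1
        rw [pow_right_comm, hy, pow_right_comm, hy, ← map_pow, ← map_pow, ← map_pow,
          ← map_mul] at h1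
        have h2 := congrArg RatFunc.intDegree ((algebraMap (RatFunc ℂ) L).injective h1)
        rw [RatFunc.intDegree_mul (pow_ne_zero _ h0) (pow_ne_zero _ hX),
          RatFunc.intDegree_pow_of_ne_zero h0, RatFunc.intDegree_pow_of_ne_zero hX,
          RatFunc.intDegree_pow_of_ne_zero hX, RatFunc.intDegree_X, mul_one, mul_one] at h2
        have h3 := congrArg (· % (s : ℤ)) h2
        simp only [Int.mul_add_emod_self_left] at h3
        rw [Int.emod_eq_of_lt (by positivity) (by exact_mod_cast (a default).2),
          Int.emod_eq_of_lt (by positivity) (by exact_mod_cast (b default).2)] at h3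
        funext i
        exact Fin.ext (by exact_mod_cast h3)) (fun _ => e)
    exact ⟨τ, hτ ()⟩
  -- The exponent is not always 1: for s = 1 it has to be 0.
  obtain ⟨k, hk⟩ : ∃ k : Fin s, ξ ^ (k : ℕ) = ξ := by
    obtain ⟨k, hk, h⟩ := hξ.eq_pow_of_pow_eq_one hξ.pow_eq_one
    exact ⟨⟨k, hk⟩, h⟩
  obtain ⟨τ, hτ⟩ := key k
  exact ⟨τ, by rw [hτ, ← map_pow, hk, ← IsScalarTower.algebraMap_apply]⟩

namespace IsRootSystem

variable {n m : ℕ} {ζ : ℂ} {y : L} {c : ZMod (n / m) → L}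

theorem neZero_div [NeZero n] [NeZero m] (hmn : m ∣ n) : NeZero (n / m) :=
  ⟨(Nat.div_pos (Nat.le_of_dvd (NeZero.pos n) hmn) (NeZero.pos m)).ne'⟩

theorem isPrimitiveRoot_pow [NeZero n] (hmn : m ∣ n) (hζ : IsPrimitiveRoot ζ n) :
    IsPrimitiveRoot (ζ ^ m) (n / m) :=
  hζ.pow (NeZero.pos n) (Nat.mul_div_cancel' hmn).symm

theorem c_pow (h : IsRootSystem n m ζ y c) (j : ZMod (n / m)) :
    c j ^ m = algebraMap ℂ L ((ζ ^ m) ^ j.val) * y + 1 := by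
  have := h.eq_zero j
  rw [← pow_mul, mul_comm m]
  linear_combination this

theorem transcendental (h : IsRootSystem n m ζ y c) : Transcendental ℂ y :=
  transcendental_of_pow_eq_X h.root_pow

theorem c_ne_zero [NeZero n] [NeZero m] (hζ : IsPrimitiveRoot ζ n) (h : IsRootSystem n m ζ y c)
    (j : ZMod (n / m)) : c j ≠ 0 := by
  intro h0
  have h1 := h.c_pow j
  rw [h0, zero_pow (NeZero.ne m)] at h1
  have hP : aeval y (C ((ζ ^ m) ^ j.val) * X + C 1 : ℂ[X]) = 0 := by
    simpa using h1.symm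
  have h2 := (transcendental_iff.1 h.transcendental) _ hP
  have h3 := congrArg (fun p => Polynomial.coeff p 1) h2
  rw [coeff_add, coeff_C_mul_X, coeff_C] at h3
  simp [hζ.ne_zero (NeZero.ne n)] at h3

/-- The Kummer base field is ℂ(y), not ℂ(w): there the c_j^m are linear polynomials with distinct
roots, so monomials in the c_j are independent modulo ℂ(y). -/
theorem exists_algEquiv_mul [NeZero n] [NeZero m] [FiniteDimensional (RatFunc ℂ) L] [IsGalois (RatFunc ℂ) L]
    (hmn : m ∣ n) {q : ℂ} (hq : IsPrimitiveRoot q m) (hζ : IsPrimitiveRoot ζ n)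
    (h : IsRootSystem n m ζ y c) (e : ZMod (n / m) → Fin m) :
    ∃ τ : L ≃ₐ[RatFunc ℂ] L, ∀ j, τ (c j) = algebraMap ℂ L (q ^ (e j : ℕ)) * c j := by
  have := neZero_div hmn
  have hξ := isPrimitiveRoot_pow hmn hζ
  let F := IntermediateField.adjoin (RatFunc ℂ) {y}
  have hyF : y ∈ F := IntermediateField.mem_adjoin_simple_self _ y
  have hcF : ∀ z : ℂ, algebraMap F L (algebraMap (RatFunc ℂ) F (algebraMap ℂ (RatFunc ℂ) z)) =
      algebraMap ℂ L z := by
    intro z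
    rw [← IsScalarTower.algebraMap_apply (RatFunc ℂ) F L, ← IsScalarTower.algebraMap_apply]
  have hinj : Function.Injective (fun j : ZMod (n / m) => (ζ ^ m) ^ j.val) := by
    intro i j hij
    exact ZMod.val_injective _ (hξ.pow_inj (ZMod.val_lt i) (ZMod.val_lt j) hij)
  obtain ⟨τ, hτ⟩ := exists_algEquiv_of_independent_roots (F := F) m
    (algebraMap (RatFunc ℂ) F (algebraMap ℂ (RatFunc ℂ) q))
    ((hq.map_of_injective (algebraMap ℂ (RatFunc ℂ)).injective).map_of_injective
      (algebraMap (RatFunc ℂ) F).injective) c (h.c_ne_zero hζ)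
    (fun j => ⟨algebraMap (RatFunc ℂ) F (algebraMap ℂ (RatFunc ℂ) ((ζ ^ m) ^ j.val)) * ⟨y, hyF⟩ + 1,
      by rw [h.c_pow, map_add, map_mul, hcF, map_one]; rfl⟩)
    (by
      intro a b f hab
      obtain ⟨P, Q, hPQ⟩ := exists_polynomial_fraction h.root_pow (f : L) f.2
      have hne : ∀ a : ZMod (n / m) → Fin m, ∏ i, c i ^ (a i : ℕ) ≠ 0 := fun a =>
        Finset.prod_ne_zero_iff.2 fun i _ => pow_ne_zero _ (h.c_ne_zero hζ i)
      have hf : (f : L) ≠ 0 := by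
        intro h0
        have h1 : algebraMap F L f = 0 := h0
        rw [h1, zero_mul] at hab
        exact hne a hab
      have hP : aeval y P ≠ 0 := by rintro h0; rw [h0, zero_div] at hPQ; exact hf hPQ
      have hQ : aeval y Q ≠ 0 := by rintro h0; rw [h0, div_zero] at hPQ; exact hf hPQ
      have hab' : aeval y Q * ∏ i, c i ^ (a i : ℕ) = aeval y P * ∏ i, c i ^ (b i : ℕ) := by
        rw [hab]
        change aeval y Q * ((f : L) * _) = _
        rw [hPQ]
        field_simp
      have hpow : ∀ a : ZMod (n / m) → Fin m, (∏ i, c i ^ (a i : ℕ)) ^ m =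
          aeval y (∏ i, (C ((ζ ^ m) ^ i.val) * X + C 1 : ℂ[X]) ^ (a i : ℕ)) := by
        intro a
        rw [← Finset.prod_pow, map_prod]
        refine Finset.prod_congr rfl fun i _ => ?_
        rw [pow_right_comm, h.c_pow]
        simp
      -- Raising to the m-th power turns the relation into a polynomial identity in y, which can be
      -- read in ℂ[X] because y is transcendental.
      have h1 := congrArg (· ^ m) hab'
      simp only [mul_pow] at h1
      rw [hpow, hpow, ← map_pow, ← map_pow, ← map_mul, ← map_mul] at h1
      exact exponents_eq_of_prod_linear _ hinj
        (fun j => pow_ne_zero _ (hξ.ne_zero (NeZero.ne _))) P Q (fun h0 => hP (by simp [h0]))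
        (fun h0 => hQ (by simp [h0])) a b
        ((transcendental_iff_injective.1 h.transcendental) h1)) e
  refine ⟨τ.restrictScalars (RatFunc ℂ), fun j => ?_⟩
  have h1 := hτ j
  rw [← map_pow, ← map_pow, hcF] at h1
  exact h1

theorem c_add_one_pow [NeZero n] [NeZero m] (hmn : m ∣ n) (hζ : IsPrimitiveRoot ζ n)
    (h : IsRootSystem n m ζ y c) (j : ZMod (n / m)) :
    c (j + 1) ^ m = algebraMap ℂ L ((ζ ^ m) ^ j.val) * (algebraMap ℂ L (ζ ^ m) * y) + 1 := by
  have := neZero_div hmn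
  have hξ := isPrimitiveRoot_pow hmn hζ
  rw [h.c_pow, ← mul_assoc, ← map_mul, ← pow_succ]
  congr 3
  rw [ZMod.val_add, ZMod.val_one_eq_one_mod, Nat.add_mod_mod]
  exact (pow_eq_pow_mod _ hξ.pow_eq_one).symm

theorem root_eq [NeZero n] [NeZero m] {q : ℂ} (hq : IsPrimitiveRoot q m)
    (hζ : IsPrimitiveRoot ζ n) (h : IsRootSystem n m ζ y c) {r : L} {j : ZMod (n / m)}
    (hr : r ^ m = c j ^ m) : ∃ e : Fin m, r = algebraMap ℂ L (q ^ (e : ℕ)) * c j := by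
  have hqL : IsPrimitiveRoot (algebraMap ℂ L q) m := hq.map_of_injective (algebraMap ℂ L).injective
  have h1 : (r / c j) ^ m = 1 := by
    rw [div_pow, hr, div_self (pow_ne_zero _ (h.c_ne_zero hζ j))]
  obtain ⟨k, hk, hk'⟩ := hqL.eq_pow_of_pow_eq_one h1
  exact ⟨⟨k, hk⟩, by rw [map_pow, hk', div_mul_cancel₀ _ (h.c_ne_zero hζ j)]⟩

/-- The c_j generate L: a root r of the splitting polynomial satisfies ((r^m - 1)/y)^s = 1, so r^m =
ξ^k y + 1 = c_k^m for some k, with ξ = ζ^m, and r is a power of q times c_k. -/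
theorem algHom_ext [NeZero n] [NeZero m] (hmn : m ∣ n) {q : ℂ} (hq : IsPrimitiveRoot q m)
    (hζ : IsPrimitiveRoot ζ n) [IsSplittingField (RatFunc ℂ) L (taftPoly n m)]
    (h : IsRootSystem n m ζ y c) {φ ψ : L →ₐ[RatFunc ℂ] L} (hφ : ∀ j, φ (c j) = ψ (c j)) :
    φ = ψ := by
  have := neZero_div hmn
  refine AlgHom.ext_of_adjoin_eq_top
    (IsSplittingField.adjoin_rootSet (K := RatFunc ℂ) L (taftPoly n m)) fun r hr => ?_
  have hy0 : y ≠ 0 := by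
    rintro rfl
    exact h.transcendental isAlgebraic_zero
  have hr0 := (mem_rootSet'.1 hr).2
  simp only [taftPoly, map_sub, map_pow, aeval_X, map_one, aeval_C, ← h.root_pow] at hr0
  have hξL : IsPrimitiveRoot (algebraMap ℂ L (ζ ^ m)) (n / m) :=
    (isPrimitiveRoot_pow hmn hζ).map_of_injective (algebraMap ℂ L).injective
  have h1 : ((r ^ m - 1) / y) ^ (n / m) = 1 := by
    rw [div_pow, sub_eq_zero.1 hr0, div_self (pow_ne_zero _ hy0)]
  obtain ⟨k, hk, hk'⟩ := hξL.eq_pow_of_pow_eq_one h1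
  have h2 : r ^ m = c (k : ZMod (n / m)) ^ m := by
    rw [h.c_pow, ZMod.val_natCast_of_lt hk, map_pow, hk', div_mul_cancel₀ _ hy0]
    ring
  obtain ⟨e, he⟩ := h.root_eq hq hζ h2
  rw [he, map_mul, map_mul, IsScalarTower.algebraMap_apply ℂ (RatFunc ℂ) L, AlgHom.commutes,
    AlgHom.commutes, hφ]

theorem algEquiv_ext [NeZero n] [NeZero m] (hmn : m ∣ n) {q : ℂ} (hq : IsPrimitiveRoot q m)
    (hζ : IsPrimitiveRoot ζ n) [IsSplittingField (RatFunc ℂ) L (taftPoly n m)]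
    (h : IsRootSystem n m ζ y c) {φ ψ : L ≃ₐ[RatFunc ℂ] L} (hφ : ∀ j, φ (c j) = ψ (c j)) :
    φ = ψ := by
  have h1 : (φ : L →ₐ[RatFunc ℂ] L) = ψ := h.algHom_ext hmn hq hζ hφ
  exact AlgEquiv.ext fun a => DFunLike.congr_fun h1 a

/-- An automorphism with y ↦ ξ y, where ξ = ζ^m, sends c_j to an m-th root of c_{j+1}^m, hence to
c_{j+1} up to a power of q. An automorphism rescaling the c_j independently removes these powers. -/
theorem exists_shift [NeZero n] [NeZero m] (hmn : m ∣ n) {q : ℂ} (hq : IsPrimitiveRoot q m)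
    (hζ : IsPrimitiveRoot ζ n) [FiniteDimensional (RatFunc ℂ) L] [IsGalois (RatFunc ℂ) L]
    (h : IsRootSystem n m ζ y c) : ∃ σ : L ≃ₐ[RatFunc ℂ] L, ∀ j, σ (c j) = c (j + 1) := by
  have := neZero_div hmn
  obtain ⟨τ, hτ⟩ := exists_algEquiv_mul_root (isPrimitiveRoot_pow hmn hζ) h.root_pow
  have hex : ∀ j, ∃ e : Fin m, τ (c j) = algebraMap ℂ L (q ^ (e : ℕ)) * c (j + 1) := by
    intro j
    refine h.root_eq hq hζ ?_
    rw [← map_pow, h.c_pow, map_add, map_mul, hτ, map_one, h.c_add_one_pow hmn hζ,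
      IsScalarTower.algebraMap_apply ℂ (RatFunc ℂ) L ((ζ ^ m) ^ j.val), AlgEquiv.commutes]
  choose e he using hex
  -- The error attached to c_j appears on c_{j+1}, whence the index shift.
  obtain ⟨υ, hυ⟩ := h.exists_algEquiv_mul hmn hq hζ (fun j => e (j - 1))
  refine ⟨τ.trans υ.symm, fun j => ?_⟩
  have h1 := hυ (j + 1)
  rw [add_sub_cancel_right] at h1
  rw [AlgEquiv.trans_apply, he, ← h1, AlgEquiv.symm_apply_apply]

/-- Because y = c_0^m - 1, its image is c_1^m - 1. -/
theorem shift_y [NeZero n] [NeZero m] (hmn : m ∣ n) (hζ : IsPrimitiveRoot ζ n)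
    (h : IsRootSystem n m ζ y c) {σ : L ≃ₐ[RatFunc ℂ] L} (hσ : ∀ j, σ (c j) = c (j + 1)) :
    σ y = algebraMap ℂ L (ζ ^ m) * y := by
  have := neZero_div hmn
  have h1 := h.c_add_one_pow hmn hζ 0
  rw [← hσ, ← map_pow, h.c_pow] at h1
  simpa using h1

theorem shift_pow [NeZero n] [NeZero m] (hmn : m ∣ n) {q : ℂ} (hq : IsPrimitiveRoot q m)
    (hζ : IsPrimitiveRoot ζ n) [IsSplittingField (RatFunc ℂ) L (taftPoly n m)]
    (h : IsRootSystem n m ζ y c) {σ : L ≃ₐ[RatFunc ℂ] L} (hσ : ∀ j, σ (c j) = c (j + 1)) :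
    σ ^ (n / m) = 1 := by
  refine h.algEquiv_ext hmn hq hζ fun j => ?_
  have h1 : ∀ k : ℕ, (σ ^ k) (c j) = c (j + k) := by
    intro k
    induction k with
    | zero => simp
    | succ k ih => rw [pow_succ', AlgEquiv.mul_apply, ih, hσ]; push_cast; rw [add_assoc]
  rw [h1, ZMod.natCast_self, add_zero]
  rfl

end IsRootSystem

/-- Any root r of the splitting polynomial gives y = r^m - 1. Since (ξ^j y)^s = w with ξ = ζ^m, the
polynomial X^m - 1 - ξ^j y divides the splitting polynomial and so has a root c_j. -/
theorem exists_isRootSystem {n m : ℕ} [NeZero n] [NeZero m] (hmn : m ∣ n) {ζ : ℂ}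
    (hζ : IsPrimitiveRoot ζ n) [IsSplittingField (RatFunc ℂ) L (taftPoly n m)] :
    ∃ (y : L) (c : ZMod (n / m) → L), IsRootSystem n m ζ y c := by
  have := IsRootSystem.neZero_div hmn
  have hξ := IsRootSystem.isPrimitiveRoot_pow hmn hζ
  have hm0 := NeZero.ne m
  have hs0 := NeZero.ne (n / m)
  have hdeg : ∀ a : L, (X ^ m - 1 - C a : L[X]).degree = m := by
    intro a
    rw [sub_sub, ← C_1, ← C_add, degree_X_pow_sub_C (NeZero.pos m)]
  have hsp := IsSplittingField.splits (K := RatFunc ℂ) L (taftPoly n m)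
  have hmap : (taftPoly n m).map (algebraMap (RatFunc ℂ) L) =
      (X ^ m - 1) ^ (n / m) - C (algebraMap (RatFunc ℂ) L RatFunc.X) := by
    simp [taftPoly]
  rw [hmap] at hsp
  have hd1 : (X ^ m - 1 : L[X]).natDegree = m := by
    rw [← C_1, natDegree_X_pow_sub_C]
  have hd2 : ((X ^ m - 1 : L[X]) ^ (n / m)).natDegree = n / m * m := by rw [natDegree_pow, hd1]
  have hd3 : ((X ^ m - 1 : L[X]) ^ (n / m) -
      C (algebraMap (RatFunc ℂ) L RatFunc.X)).natDegree = n / m * m := by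
    rw [natDegree_sub_C, hd2]
  have hpos : n / m * m ≠ 0 := mul_ne_zero hs0 hm0
  have hne : (X ^ m - 1 : L[X]) ^ (n / m) - C (algebraMap (RatFunc ℂ) L RatFunc.X) ≠ 0 := by
    intro h0
    rw [h0, natDegree_zero] at hd3
    exact hpos hd3.symm
  obtain ⟨r, hr⟩ := hsp.exists_eval_eq_zero (by
    rw [degree_eq_natDegree hne, hd3]
    exact_mod_cast hpos)
  set y := r ^ m - 1 with hy
  have hyw : y ^ (n / m) = algebraMap (RatFunc ℂ) L RatFunc.X := by
    simpa [sub_eq_zero] using hr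
  have hroot : ∀ j : ZMod (n / m), ∃ z : L, z ^ m - algebraMap ℂ L (ζ ^ (j.val * m)) * y - 1 = 0 := by
    intro j
    have hd : (X ^ m - 1 - C (algebraMap ℂ L (ζ ^ (j.val * m)) * y) : L[X]) ∣
        (X ^ m - 1) ^ (n / m) - C (algebraMap (RatFunc ℂ) L RatFunc.X) := by
      have h1 : (algebraMap ℂ L (ζ ^ (j.val * m)) * y) ^ (n / m) =
          algebraMap (RatFunc ℂ) L RatFunc.X := by
        rw [mul_pow, hyw, ← map_pow, mul_comm j.val, pow_mul, pow_right_comm, hξ.pow_eq_one,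
          one_pow, map_one, one_mul]
      rw [← h1, C_pow]
      exact sub_dvd_pow_sub_pow _ _ _
    obtain ⟨z, hz⟩ := (hsp.of_dvd hne hd).exists_eval_eq_zero (by
      rw [hdeg]; exact_mod_cast hm0)
    refine ⟨z, ?_⟩
    simp only [eval_sub, eval_pow, eval_X, eval_one, eval_C] at hz
    linear_combination hz
  choose c hc using hroot
  exact ⟨y, c, hyw, hc⟩

end RootSystem

/-! ### The Ore extension: normal form, absence of zero divisors, center -/

section OreBasics

namespace OreExt

variable {k L : Type*} [Field k] [Field L] [Algebra k L] (σ : L ≃ₐ[k] L)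

theorem t_mul_C (a : L) : t σ * C σ a = C σ (σ.symm a) * t σ := by
  rw [C_mul_t, AlgEquiv.apply_symm_apply]

theorem t_pow_mul_C (i : ℕ) (a : L) : t σ ^ i * C σ a = C σ ((σ.symm ^ i) a) * t σ ^ i := by
  induction i generalizing a with
  | zero => simp
  | succ i ih => rw [pow_succ, mul_assoc, t_mul_C, ← mul_assoc, ih, pow_succ, AlgEquiv.mul_apply,
      mul_assoc]

theorem monomial_eq (i : ℕ) (a : SkewCoeff σ) :
    SkewPolynomial.monomial i a = C σ ((SkewCoeff.of σ).symm a) * t σ ^ i := by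
  rw [t, ← SkewPolynomial.monomial_one_right_eq_X_pow]
  change _ = SkewPolynomial.CRingHom a * _
  rw [SkewPolynomial.CRingHom_eq_C, SkewPolynomial.C_mul_monomial, mul_one]

/-- The coefficient of `t ^ i`, with coefficients written on the left. -/
def coeff (r : OreExt σ) (i : ℕ) : L := (SkewCoeff.of σ).symm (SkewPolynomial.coeff r i)

theorem ext_coeff {r r' : OreExt σ} (h : ∀ i, coeff σ r i = coeff σ r' i) : r = r' :=
  SkewPolynomial.ext fun i => (SkewCoeff.of σ).symm.injective (h i)

theorem coeff_add (r r' : OreExt σ) (i : ℕ) : coeff σ (r + r') i = coeff σ r i + coeff σ r' i := by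
  simp [coeff, SkewPolynomial.coeff_add]

theorem coeff_C_mul_t_pow (a : L) (i j : ℕ) :
    coeff σ (C σ a * t σ ^ i) j = if i = j then a else 0 := by
  have h := monomial_eq σ i (SkewCoeff.of σ a)
  rw [AlgEquiv.symm_apply_apply] at h
  rw [← h, coeff, SkewPolynomial.coeff_monomial]
  split_ifs <;> simp

theorem induction {P : OreExt σ → Prop} (h0 : P 0) (hadd : ∀ r r', P r → P r' → P (r + r'))
    (hmon : ∀ a i, P (C σ a * t σ ^ i)) (r : OreExt σ) : P r := by
  induction r using SkewPolynomial.induction with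
  | h0 => exact h0
  | ha n a r _ _ hr => exact hadd _ _ (monomial_eq σ n a ▸ hmon _ _) hr

theorem C_injective : Function.Injective (C σ) := (C σ).injective

instance : Nontrivial (OreExt σ) := (C_injective σ).nontrivial

/-- Only the two leading terms contribute to the top degree, and their product is nonzero because
powers of σ are injective. Degrees live in `Multiplicative ℕ`, so the top degree is written `i * j`.
-/
instance : NoZeroDivisors (OreExt σ) where
  eq_zero_or_eq_zero_of_mul_eq_zero := by
    classical
    intro p r hpr
    by_contra! hne
    obtain ⟨hp, hr⟩ := hne
    have hps : (SkewMonoidAlgebra.support p).Nonempty := Finset.nonempty_iff_ne_empty.2 (by simpa using hp)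
    have hrs : (SkewMonoidAlgebra.support r).Nonempty := Finset.nonempty_iff_ne_empty.2 (by simpa using hr)
    set i := (SkewMonoidAlgebra.support p).max' hps with hi
    set j := (SkewMonoidAlgebra.support r).max' hrs with hj
    have hpi : SkewMonoidAlgebra.coeff p i ≠ 0 := SkewMonoidAlgebra.mem_support_iff.1 (Finset.max'_mem _ hps)
    have hrj : SkewMonoidAlgebra.coeff r j ≠ 0 := SkewMonoidAlgebra.mem_support_iff.1 (Finset.max'_mem _ hrs)
    have h1 : SkewMonoidAlgebra.coeff (p * r) (i * j) = SkewMonoidAlgebra.coeff p i * i • SkewMonoidAlgebra.coeff r j := by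
      rw [SkewMonoidAlgebra.coeff_mul, SkewMonoidAlgebra.sum_def', Finset.sum_eq_single i]
      · rw [SkewMonoidAlgebra.sum_def', Finset.sum_eq_single j]
        · simp
        · intro b hb hbj
          rw [if_neg]
          intro h
          exact hbj (mul_left_cancel h)
        · simp [hrj]
      · intro a ha hai
        rw [SkewMonoidAlgebra.sum_def']
        refine Finset.sum_eq_zero fun b hb => if_neg fun h => ?_
        have h2 : a < i := lt_of_le_of_ne (Finset.le_max' _ _ ha) hai
        have h3 : b ≤ j := Finset.le_max' _ _ hb
        have h4 : a * b < i * j := mul_lt_mul_of_lt_of_le h2 h3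
        exact h4.ne h
      · simp [hpi]
    rw [hpr, SkewMonoidAlgebra.coeff_zero] at h1
    refine mul_ne_zero hpi ?_ h1.symm
    rw [SkewCoeff.smul_def]
    exact (map_ne_zero ((SkewCoeff.aut σ)⁻¹ ^ i.toAdd)).2 hrj

instance : IsDomain (OreExt σ) := NoZeroDivisors.to_isDomain _

theorem t_ne_zero : t σ ≠ 0 := SkewPolynomial.X_ne_zero

/-- The universal property of `L[t; σ]`. -/
def lift {B : Type*} [Ring B] (f : L →+* B) (T : B) (h : ∀ a, f a * T = T * f (σ a)) :
    OreExt σ →+* B :=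
  SkewMonoidAlgebra.liftNCRingHom (f.comp ((SkewCoeff.of σ).symm : SkewCoeff σ →+* L))
    (powersHom B T) (by
      have key : ∀ (i : ℕ) (a : SkewCoeff σ), f ((SkewCoeff.of σ).symm (Multiplicative.ofAdd i • a))
          * T ^ i = T ^ i * f ((SkewCoeff.of σ).symm a) := by
        intro i
        induction i with
        | zero => simp
        | succ i ih =>
          intro a
          have h1 : σ ((SkewCoeff.of σ).symm (Multiplicative.ofAdd 1 • a)) =
              (SkewCoeff.of σ).symm a := by
            rw [SkewCoeff.smul_def, toAdd_ofAdd, pow_one, AlgEquiv.aut_inv]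
            exact (SkewCoeff.of σ).injective ((SkewCoeff.aut σ).apply_symm_apply a)
          rw [ofAdd_add, mul_smul, pow_succ, ← mul_assoc, ih, mul_assoc, h, ← mul_assoc, h1]
      intro a i
      exact key i.toAdd a)

section lift

variable {B : Type*} [Ring B] (f : L →+* B) (T : B) (h : ∀ a, f a * T = T * f (σ a))

theorem lift_C (a : L) : lift σ f T h (C σ a) = f a := by
  change SkewMonoidAlgebra.liftNC _ _ (SkewMonoidAlgebra.single _ _) = _
  rw [SkewMonoidAlgebra.liftNC_single]
  simp

theorem lift_t : lift σ f T h (t σ) = T := by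
  change SkewMonoidAlgebra.liftNC _ _ (SkewMonoidAlgebra.single _ _) = _
  rw [SkewMonoidAlgebra.liftNC_single]
  simp

end lift

theorem ringHom_ext {B : Type*} [Ring B] {f f' : OreExt σ →+* B}
    (hC : ∀ a, f (C σ a) = f' (C σ a)) (ht : f (t σ) = f' (t σ)) : f = f' := by
  refine RingHom.ext fun r => ?_
  induction r using induction with
  | h0 => simp
  | hadd r r' h h' => simp only [map_add, h, h']
  | hmon a i => simp only [map_mul, map_pow, hC, ht]

theorem mem_center {z : OreExt σ} (hC : ∀ a, C σ a * z = z * C σ a) (ht : t σ * z = z * t σ) :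
    z ∈ Subring.center (OreExt σ) := by
  refine Subring.mem_center_iff.2 fun r => ?_
  induction r using induction with
  | h0 => simp
  | hadd r r' h h' => simp only [add_mul, mul_add, h, h']
  | hmon a i =>
    have h1 : Commute z (C σ a) := (hC a).symm
    have h2 : Commute z (t σ) := ht.symm
    exact (h1.mul_right (h2.pow_right i)).symm

theorem symm_pow_eq_one {s : ℕ} (hs : σ ^ s = 1) : σ.symm ^ s = 1 := by
  have : σ.symm = σ⁻¹ := rfl
  rw [this, inv_pow, hs, inv_one]

theorem t_pow_mem_center {s : ℕ} (hs : σ ^ s = 1) : t σ ^ s ∈ Subring.center (OreExt σ) :=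
  mem_center σ (fun a => by rw [t_pow_mul_C, symm_pow_eq_one σ hs]; rfl)
    ((Commute.refl (t σ)).pow_right s)

theorem C_mem_center {a : L} (ha : σ a = a) : C σ a ∈ Subring.center (OreExt σ) :=
  mem_center σ (fun b => by rw [← map_mul, ← map_mul, mul_comm]) (by rw [C_mul_t, ha])

/-- The fixed field elements and t^s are central, so the products a t^i, with a in a finite spanning
set of L over F and i < s, generate. -/
theorem finite_center {F : Type*} [Field F] [Algebra F L] [Module.Finite F L]
    (hF : ∀ f : F, σ (algebraMap F L f) = algebraMap F L f) {s : ℕ} [NeZero s] (hs : σ ^ s = 1) :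
    Module.Finite (Subring.center (OreExt σ)) (OreExt σ) := by
  obtain ⟨S, hS⟩ := Module.Finite.fg_top (R := F) (M := L)
  let G : Set (OreExt σ) := Set.image2 (fun a i => C σ a * t σ ^ i) S (Set.Iio s)
  have hG : G.Finite := Set.Finite.image2 _ S.finite_toSet (Set.finite_Iio s)
  refine ⟨Submodule.fg_def.2 ⟨G, hG, Submodule.eq_top_iff'.2 fun r => ?_⟩⟩
  induction r using induction with
  | h0 => exact zero_mem _
  | hadd r r' h h' => exact add_mem h h'
  | hmon a i =>
    have ha : a ∈ Submodule.span F (S : Set L) := by rw [hS]; trivial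
    induction ha using Submodule.span_induction with
    | zero => simp
    | add a b _ _ ha hb => rw [map_add, add_mul]; exact add_mem ha hb
    | smul f a _ ha =>
      rw [Algebra.smul_def, map_mul, mul_assoc]
      exact Submodule.smul_mem _ (⟨_, C_mem_center σ (hF f)⟩ : Subring.center (OreExt σ)) ha
    | mem a ha =>
      have h1 : C σ a * t σ ^ i = (t σ ^ s) ^ (i / s) * (C σ a * t σ ^ (i % s)) := by
        have hz := Subring.mem_center_iff.1 (pow_mem (t_pow_mem_center σ hs) (i / s)) (C σ a)
        rw [← mul_assoc, ← hz, mul_assoc, ← pow_mul, ← pow_add, Nat.div_add_mod]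
      rw [h1]
      exact Submodule.smul_mem _
        (⟨_, pow_mem (t_pow_mem_center σ hs) (i / s)⟩ : Subring.center (OreExt σ))
        (Submodule.subset_span ⟨a, ha, _, Nat.mod_lt _ (NeZero.pos s), rfl⟩)

end OreExt

end OreBasics

/-! ### Localization at the central regular elements -/

section CenterFracBasics

namespace CenterFrac

variable {A : Type*} [Ring A]

/-- The inclusion of `A` in its ring of fractions. -/
abbrev num : A →+* CenterFrac A := OreLocalization.numeratorRingHom

theorem isUnit_num (s : centralRegular A) : IsUnit (num (s : A)) :=
  OreLocalization.numerator_isUnit s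

theorem exists_rep (x : CenterFrac A) :
    ∃ (r : A) (s : centralRegular A), num (s : A) * x = num r := by
  induction x using OreLocalization.ind with
  | _ r s => exact ⟨r, s, OreLocalization.mul_cancel⟩

theorem num_mem_center {z : A} (hz : z ∈ Subring.center A) :
    num z ∈ Subring.center (CenterFrac A) := by
  refine Subring.mem_center_iff.2 fun x => ?_
  obtain ⟨r, s, h⟩ := exists_rep x
  refine (isUnit_num s).mul_left_cancel ?_
  rw [← mul_assoc, h, ← mul_assoc, ← map_mul (num) (s : A), Subring.mem_center_iff.1 hz, map_mul,
    mul_assoc, h, ← map_mul, ← map_mul, Subring.mem_center_iff.1 hz]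

theorem num_central (s : centralRegular A) : num (s : A) ∈ Subring.center (CenterFrac A) :=
  num_mem_center s.2.1

theorem ringHom_ext {B : Type*} [Ring B] {f f' : CenterFrac A →+* B}
    (h : ∀ r : A, f (num r) = f' (num r)) : f = f' := by
  refine RingHom.ext fun x => ?_
  obtain ⟨r, s, hx⟩ := exists_rep x
  refine ((isUnit_num s).map f).mul_left_cancel ?_
  rw [← map_mul, hx, h, ← hx, map_mul, h]

theorem num_injective : Function.Injective (num : A →+* CenterFrac A) :=
  OreLocalization.numeratorHom_inj fun _ hs => hs.2.1

/-- The extension of a ring homomorphism to the ring of fractions. -/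
def lift {B : Type*} [Ring B] (f : A →+* B) (hf : ∀ s : centralRegular A, IsUnit (f s)) :
    CenterFrac A →+* B :=
  OreLocalization.universalHom f
    (IsUnit.liftRight ((f : A →* B).comp (centralRegular A).subtype) hf) fun _ => rfl

theorem lift_num {B : Type*} [Ring B] (f : A →+* B) (hf : ∀ s : centralRegular A, IsUnit (f s))
    (r : A) : lift f hf (num r) = f r :=
  OreLocalization.universalHom_commutes _ _ _

theorem mem_centralRegular [IsDomain A] {z : A} (hz : z ∈ Subring.center A) (h0 : z ≠ 0) :
    z ∈ centralRegular A :=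
  ⟨hz, mem_nonZeroDivisors_of_ne_zero h0⟩

/-- The constant coefficient of the minimal polynomial of a over the center is, up to sign, a times
a polynomial in a. It is nonzero: otherwise, in a domain, dividing by X would leave a monic
polynomial of smaller degree that annihilates a. -/
theorem exists_mul_mem_center [IsDomain A] [Module.Finite (Subring.center A) A] {a : A}
    (ha : a ≠ 0) : ∃ b : A, a * b ∈ Subring.center A ∧ a * b ≠ 0 := by
  have hint : IsIntegral (Subring.center A) a := IsIntegral.of_finite _ a
  set p := minpoly (Subring.center A) a with hp
  have hpm : p.Monic := minpoly.monic hint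
  have h1 : Polynomial.aeval a p = 0 := minpoly.aeval _ _
  have h2 : a * Polynomial.aeval a p.divX + algebraMap (Subring.center A) A (p.coeff 0) = 0 := by
    rw [← h1]
    conv_rhs => rw [← Polynomial.X_mul_divX_add p]
    rw [map_add, map_mul, Polynomial.aeval_X, Polynomial.aeval_C]
  have hdeg : p.natDegree ≠ 0 := by
    intro h0
    have h3 := hpm.natDegree_eq_zero.1 h0
    rw [h3] at h1
    simp at h1
  have hc : p.coeff 0 ≠ 0 := by
    intro h0
    rw [h0, map_zero, add_zero] at h2
    have h3 := (mul_eq_zero.1 h2).resolve_left ha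
    have h4 : p.divX.Monic := by
      rw [Polynomial.Monic, Polynomial.leadingCoeff, Polynomial.natDegree_divX_eq_natDegree_tsub_one,
        Polynomial.coeff_divX, Nat.sub_add_cancel (Nat.pos_of_ne_zero hdeg)]
      exact hpm
    have h5 := minpoly.min (Subring.center A) a h4 h3
    rw [← hp] at h5
    have h6 := Polynomial.natDegree_le_natDegree h5
    rw [Polynomial.natDegree_divX_eq_natDegree_tsub_one] at h6
    omega
  refine ⟨Polynomial.aeval a p.divX, ?_⟩
  have h3 : a * Polynomial.aeval a p.divX = ((-(p.coeff 0) : Subring.center A) : A) := by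
    rw [eq_neg_of_add_eq_zero_left h2]; rfl
  rw [h3]
  exact ⟨Subtype.property _, fun h => hc (neg_eq_zero.1 (Subtype.ext h))⟩

theorem isUnit_num_of_ne_zero [IsDomain A] [Module.Finite (Subring.center A) A] {a : A}
    (ha : a ≠ 0) : IsUnit (num a) := by
  obtain ⟨b, hz, h0⟩ := exists_mul_mem_center ha
  have hu : IsUnit (num (a * b)) := isUnit_num ⟨_, mem_centralRegular hz h0⟩
  -- As ab is central, a(ba) = (ab)a = a(ab), and a cancels. Commuting factors of a unit are units
  -- on both sides.
  have hba : b * a = a * b := by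
    refine mul_left_cancel₀ ha ?_
    rw [← mul_assoc, ← Subring.mem_center_iff.1 hz a]
  have h1 : Commute (num a) (num b) := by
    rw [Commute, SemiconjBy, ← map_mul, ← map_mul, hba]
  rw [map_mul] at hu
  exact (h1.isUnit_mul_iff.1 hu).1

theorem isUnit_of_ne_zero [IsDomain A] [Module.Finite (Subring.center A) A] {x : CenterFrac A}
    (hx : x ≠ 0) : IsUnit x := by
  obtain ⟨r, s, h⟩ := exists_rep x
  have hr : r ≠ 0 := by
    rintro rfl
    rw [map_zero] at h
    exact hx (((isUnit_num s).mul_right_eq_zero).1 h)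
  have h1 := isUnit_num_of_ne_zero hr
  rw [← h] at h1
  obtain ⟨u, hu⟩ := isUnit_num s
  rw [← hu] at h1
  exact (Units.isUnit_units_mul u x).1 h1

instance [Nontrivial A] : Nontrivial (CenterFrac A) := num_injective.nontrivial

/-- Denominators are central, so generators of A over its center still generate after localization.
-/
instance [Nontrivial A] [Module.Finite (Subring.center A) A] :
    Module.Finite (Subring.center (CenterFrac A)) (CenterFrac A) := by
  obtain ⟨S, hS⟩ := Module.Finite.fg_top (R := Subring.center A) (M := A)
  have h1 : ∀ r : A, num r ∈ Submodule.span (Subring.center (CenterFrac A)) (num '' (S : Set A)) := by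
    intro r
    have hr : r ∈ Submodule.span (Subring.center A) (S : Set A) := by rw [hS]; trivial
    induction hr using Submodule.span_induction with
    | mem r hr => exact Submodule.subset_span ⟨r, hr, rfl⟩
    | zero => rw [map_zero]; exact zero_mem _
    | add r r' _ _ h h' => rw [map_add]; exact add_mem h h'
    | smul z r _ h =>
      have : num (z • r) = (⟨num z, num_mem_center z.2⟩ : Subring.center (CenterFrac A)) • num r :=
        map_mul num (z : A) r
      rw [this]
      exact Submodule.smul_mem _ _ h
  refine ⟨Submodule.fg_def.2 ⟨_, S.finite_toSet.image num, Submodule.eq_top_iff'.2 fun x => ?_⟩⟩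
  obtain ⟨r, s, hx⟩ := exists_rep x
  obtain ⟨u, hu⟩ := isUnit_num s
  have hc : (↑u⁻¹ : CenterFrac A) ∈ Subring.center (CenterFrac A) := by
    refine Subring.mem_center_iff.2 fun y => ?_
    have h2 : Commute y (u : CenterFrac A) := by
      rw [hu]; exact Subring.mem_center_iff.1 (num_central s) y
    exact h2.units_inv_right
  have h3 : x = (⟨_, hc⟩ : Subring.center (CenterFrac A)) • num r := by
    change x = ↑u⁻¹ * num r
    rw [← hx, ← hu, Units.inv_mul_cancel_left]
  rw [h3]
  exact Submodule.smul_mem _ _ (h1 r)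

end CenterFrac

end CenterFracBasics

/-! ### Independence of the monomials X^i G^j in a bialgebra -/

section SkewPrimitive

theorem qBinom_succ_self_ne_zero {k : Type*} [Field k] {q : k} {m : ℕ} (hq : IsPrimitiveRoot q m)
    (i : ℕ) (hi : i + 1 < m) : qBinom q (i + 1) i ≠ 0 := by
  induction i with
  | zero => simp
  | succ i ih =>
    intro h0
    have h1 := one_sub_mul_qBinom q (i + 1) i
    rw [h0, mul_zero] at h1
    have h2 : 1 - q ^ (i + 1 + 1) ≠ 0 :=
      sub_ne_zero.2 (hq.pow_ne_one_of_pos_of_lt (by omega) (by omega)).symm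
    exact (mul_ne_zero h2 (ih (by omega))) h1.symm

section Weight

variable {k K : Type*} [Field k] [Ring K] [Algebra k K]

/-- Up to the factor `m`, the projection to the eigenspace for `q ^ r` of conjugation by `G`, where
`G ^ n = 1`. -/
def weightProj (q : k) (m n : ℕ) (G : K) (r : ℕ) : K →ₗ[k] K :=
  ∑ l ∈ Finset.range m, (q⁻¹ ^ r) ^ l •
    (LinearMap.mulLeft k (G ^ l) ∘ₗ LinearMap.mulRight k (G ^ ((n - 1) * l)))

theorem pow_mul_pow_of_qcomm {q : k} {X G : K} (h : G * X = q • (X * G)) (l i : ℕ) :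
    G ^ l * X ^ i = (q ^ i) ^ l • (X ^ i * G ^ l) := by
  have h1 : ∀ i, G * X ^ i = q ^ i • (X ^ i * G) := by
    intro i
    induction i with
    | zero => simp
    | succ i ih =>
      rw [pow_succ, ← mul_assoc, ih, smul_mul_assoc, mul_assoc, h, mul_smul_comm, smul_smul,
        ← pow_succ, ← mul_assoc]
  induction l with
  | zero => simp
  | succ l ih =>
    rw [pow_succ', mul_assoc, ih, mul_smul_comm, ← mul_assoc, h1, smul_mul_assoc, smul_smul,
      ← pow_succ, mul_assoc, ← pow_succ']

/-- Conjugation by G multiplies X^i G^j by q^i, so the sum defining the projection is a geometric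
series in q^(i-r), equal to m or 0. The factor `G ^ ((n - 1) * l)` plays the role of G^(-l). -/
theorem weightProj_apply {q : k} {m n : ℕ} (hn : 0 < n) (hq : IsPrimitiveRoot q m) {X G : K}
    (h : G * X = q • (X * G)) (hG : G ^ n = 1) {r i : ℕ} (hr : r < m) (hi : i < m) (j : ℕ) :
    weightProj q m n G r (X ^ i * G ^ j) = if i = r then (m : k) • (X ^ i * G ^ j) else 0 := by
  have hq0 : q ≠ 0 := hq.ne_zero (by omega)
  have h1 : ∀ l : ℕ, G ^ l * (X ^ i * G ^ j * G ^ ((n - 1) * l)) =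
      (q ^ i) ^ l • (X ^ i * G ^ j) := by
    intro l
    rw [← mul_assoc, ← mul_assoc, pow_mul_pow_of_qcomm h, smul_mul_assoc, smul_mul_assoc,
      mul_assoc, mul_assoc, ← pow_add, ← pow_add]
    have h2 : l + (j + (n - 1) * l) = n * l + j := by
      obtain ⟨n, rfl⟩ := Nat.exists_eq_succ_of_ne_zero hn.ne'
      simp only [Nat.succ_eq_add_one, Nat.add_sub_cancel]
      ring
    rw [h2, pow_add, pow_mul, hG, one_pow, one_mul]
  simp only [weightProj, LinearMap.sum_apply, LinearMap.smul_apply, LinearMap.comp_apply,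
    LinearMap.mulLeft_apply, LinearMap.mulRight_apply, h1, smul_smul, ← mul_pow]
  rw [← Finset.sum_smul]
  split_ifs with hir
  · subst hir
    rw [← mul_pow, inv_mul_cancel₀ hq0]
    simp
  · have hz : q⁻¹ ^ r * q ^ i ≠ 1 := by
      intro h0
      apply hir
      apply hq.pow_inj hi hr
      rw [inv_pow] at h0
      exact (inv_mul_eq_one₀ (pow_ne_zero _ hq0)).1 h0 |>.symm
    have h2 := geom_sum_mul (q⁻¹ ^ r * q ^ i) m
    have h3 : (q⁻¹ ^ r * q ^ i) ^ m = 1 := by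
      rw [mul_pow, pow_right_comm, pow_right_comm q, inv_pow, hq.pow_eq_one]
      simp
    rw [h3, sub_self] at h2
    rw [(mul_eq_zero.1 h2).resolve_right (sub_ne_zero.2 hz), zero_smul]

end Weight

variable {k K : Type*} [Field k] [Ring K] [Bialgebra k K]

theorem linearIndependent_pow_of_isGroupLikeElem {n : ℕ} {G : K} (hG : IsGroupLikeElem k G)
    (hinj : Function.Injective fun j : Fin n => G ^ (j : ℕ)) :
    LinearIndependent k fun j : Fin n => G ^ (j : ℕ) := by
  have h1 : ∀ j : ℕ, IsGroupLikeElem k (G ^ j) := by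
    intro j
    induction j with
    | zero => rw [pow_zero]; exact IsGroupLikeElem.one
    | succ j ih => rw [pow_succ]; exact ih.mul hG
  have h2 : LinearIndepOn k id (Set.range fun j : Fin n => G ^ (j : ℕ)) :=
    (linearIndepOn_isGroupLikeElem (R := k) (A := K)).mono (by rintro _ ⟨j, rfl⟩; exact h1 j)
  exact (linearIndepOn_range_iff hinj id).1 h2 |>.comp id Function.injective_id

variable {m n : ℕ} {q : k} {X G : K}

/-- The summands X ⊗ 1 and G ⊗ X of Δ(X) q-commute, so the q-binomial theorem applies. -/
theorem comul_skewPrimitive_pow_mul (h : G * X = q • (X * G)) (hG : IsGroupLikeElem k G)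
    (hX : Coalgebra.comul (R := k) X = X ⊗ₜ 1 + G ⊗ₜ X) (N b : ℕ) :
    Coalgebra.comul (R := k) (X ^ N * G ^ b) = ∑ a ∈ Finset.range (N + 1),
      qBinom q N a • ((X ^ a * G ^ (N - a) * G ^ b) ⊗ₜ[k] (X ^ (N - a) * G ^ b)) := by
  have hGb : Coalgebra.comul (R := k) (G ^ b) = (G ^ b) ⊗ₜ[k] (G ^ b) := by
    rw [Bialgebra.comul_pow, hG.comul_eq_tmul_self, Algebra.TensorProduct.tmul_pow]
  rw [Bialgebra.comul_mul, Bialgebra.comul_pow, hX, hGb, add_pow_qBinom q, Finset.sum_mul]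
  · refine Finset.sum_congr rfl fun a _ => ?_
    rw [smul_mul_assoc, Algebra.TensorProduct.tmul_pow, Algebra.TensorProduct.tmul_pow, one_pow,
      Algebra.TensorProduct.tmul_mul_tmul, Algebra.TensorProduct.tmul_mul_tmul, one_mul]
  · simp only [Algebra.TensorProduct.tmul_mul_tmul, one_mul, mul_one]
    rw [h, TensorProduct.smul_tmul']

/-- A functional on the second tensor factor that sees only weight 1 picks out a single term of the
q-binomial expansion. This lowers the power of X by one and drives the induction below. -/
theorem contract_comul_skewPrimitive_pow_mul (hn : 0 < n) (hq : IsPrimitiveRoot q m)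
    (h : G * X = q • (X * G)) (hGn : G ^ n = 1) (hG : IsGroupLikeElem k G)
    (hX : Coalgebra.comul (R := k) X = X ⊗ₜ 1 + G ⊗ₜ X) (φ : K →ₗ[k] k) (i : ℕ) (hi : i + 1 < m)
    (b : ℕ) :
    TensorProduct.rid k K ((φ ∘ₗ weightProj q m n G 1).lTensor K
      (Coalgebra.comul (X ^ (i + 1) * G ^ b))) =
      (qBinom q (i + 1) i * (m * φ (X * G ^ b))) • (X ^ i * G ^ b * G) := by
  have hφ : ∀ a : ℕ, a < m → φ (weightProj q m n G 1 (X ^ a * G ^ b)) =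
      if a = 1 then m * φ (X * G ^ b) else 0 := by
    intro a ha
    rw [weightProj_apply hn hq h hGn (by omega) ha]
    split_ifs with h1
    · subst h1; simp
    · simp
  rw [comul_skewPrimitive_pow_mul h hG hX, map_sum, map_sum, Finset.sum_eq_single i]
  · rw [map_smul, map_smul, LinearMap.lTensor_tmul, TensorProduct.rid_tmul, LinearMap.comp_apply,
      hφ _ (by omega), if_pos (by omega), smul_smul, Nat.add_sub_cancel_left, pow_one, mul_assoc,
      mul_assoc, ← pow_succ', ← pow_succ]
  · intro a ha hai
    have ha := Finset.mem_range.1 ha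
    rw [map_smul, map_smul, LinearMap.lTensor_tmul, TensorProduct.rid_tmul, LinearMap.comp_apply,
      hφ _ (by omega), if_neg (by omega), zero_smul, smul_zero]
  · intro hi'
    exact absurd (Finset.mem_range.2 (by omega)) hi'

/-- Induction on i: contraction turns a relation among the X^(i+1) G^j into one among the X^i G^j,
with coefficients multiplied by φ(X G^j) and by a q-binomial that is nonzero for i + 1 < m. The
start is the independence of distinct grouplike elements. -/
theorem eq_zero_of_sum_skewPrimitive_pow (hn : 0 < n) (hm : (m : k) ≠ 0) (hq : IsPrimitiveRoot q m)
    (h : G * X = q • (X * G)) (hGn : G ^ n = 1) (hG : IsGroupLikeElem k G)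
    (hinj : Function.Injective fun j : Fin n => G ^ (j : ℕ))
    (hX : Coalgebra.comul (R := k) X = X ⊗ₜ 1 + G ⊗ₜ X) (hX0 : 1 < m → X ≠ 0) (i : ℕ) (hi : i < m)
    (f : Fin n → k) (hf : ∑ j, f j • (X ^ i * G ^ (j : ℕ)) = 0) (j : Fin n) : f j = 0 := by
  induction i generalizing f j with
  | zero =>
    simp only [pow_zero, one_mul] at hf
    have h1 := linearIndependent_pow_of_isGroupLikeElem hG hinj
    exact Fintype.linearIndependent_iff.1 h1 f hf j
  | succ i ih =>
    have hXG : X * G ^ (j : ℕ) ≠ 0 := by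
      intro h0
      apply hX0 (by omega)
      have h1 : X * G ^ (j : ℕ) * G ^ (n - j : ℕ) = X := by
        rw [mul_assoc, ← pow_add, Nat.add_sub_cancel' j.2.le, hGn, mul_one]
      rw [← h1, h0, zero_mul]
    -- The functional is adapted to the one index j whose coefficient is to be shown zero; it may
    -- vanish at the others.
    obtain ⟨φ, hφ⟩ : ∃ φ : K →ₗ[k] k, φ (X * G ^ (j : ℕ)) ≠ 0 :=
      Module.Projective.exists_dual_ne_zero k hXG
    -- The factor `G ^ (n - 1)` cancels the extra G produced by the contraction.
    have h1 := congrArg (fun z => TensorProduct.rid k K ((φ ∘ₗ weightProj q m n G 1).lTensor K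
      (Coalgebra.comul z)) * G ^ (n - 1)) hf
    simp only [map_sum, map_smul, map_zero, zero_mul, Finset.sum_mul,
      contract_comul_skewPrimitive_pow_mul hn hq h hGn hG hX φ i hi, smul_smul, smul_mul_assoc] at h1
    have hGG : G * G ^ (n - 1) = 1 := by rw [← pow_succ', Nat.sub_add_cancel hn, hGn]
    simp only [mul_assoc _ G (G ^ (n - 1)), hGG, mul_one] at h1
    have h2 := ih (by omega) _ h1 j
    exact (mul_eq_zero.1 h2).resolve_right
      (mul_ne_zero (qBinom_succ_self_ne_zero hq i hi) (mul_ne_zero hm hφ))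

/-- Different powers of X have different weights under conjugation by G, so a relation splits into
relations with a fixed power of X. For m = 1 no positive power of X occurs, hence the guarded
hypothesis on X. -/
theorem linearIndependent_skewPrimitive_mul_groupLike (hn : 0 < n) (hm : (m : k) ≠ 0)
    (hq : IsPrimitiveRoot q m) (h : G * X = q • (X * G)) (hGn : G ^ n = 1)
    (hG : IsGroupLikeElem k G) (hinj : Function.Injective fun j : Fin n => G ^ (j : ℕ))
    (hX : Coalgebra.comul (R := k) X = X ⊗ₜ 1 + G ⊗ₜ X) (hX0 : 1 < m → X ≠ 0) :
    LinearIndependent k fun p : Fin m × Fin n => X ^ (p.1 : ℕ) * G ^ (p.2 : ℕ) := by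
  refine Fintype.linearIndependent_iff.2 fun f hf p => ?_
  obtain ⟨r, j⟩ := p
  have h1 := congrArg (weightProj q m n G r) hf
  rw [map_zero, map_sum, Fintype.sum_prod_type, Finset.sum_eq_single r] at h1
  · simp only [map_smul, weightProj_apply hn hq h hGn r.2 r.2, if_pos] at h1
    have h2 := eq_zero_of_sum_skewPrimitive_pow hn hm hq h hGn hG hinj hX hX0 r r.2
      (fun j => f (r, j) * m) (by simpa only [smul_smul] using h1) j
    exact (mul_eq_zero.1 h2).resolve_right hm
  · intro i _ hir
    refine Finset.sum_eq_zero fun j _ => ?_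
    rw [map_smul, weightProj_apply hn hq h hGn r.2 i.2, if_neg (fun h => hir (Fin.ext h)), smul_zero]
  · simp

end SkewPrimitive

/-! ### The monomial basis of T, and criteria for its actions -/

namespace GenTaft

variable {n m : ℕ} {α q : ℂ} {hq : IsPrimitiveRoot q m}

theorem span_x_pow_mul_g_pow [NeZero n] [NeZero m] :
    Submodule.span ℂ (Set.range fun p : Fin m × Fin n =>
      x n m α hq ^ (p.1 : ℕ) * g n m α hq ^ (p.2 : ℕ)) = ⊤ := by
  set S : Set (GenTaft n m α hq) :=
    Set.range fun p : Fin m × Fin n => x n m α hq ^ (p.1 : ℕ) * g n m α hq ^ (p.2 : ℕ) with hS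
  have key : ∀ i j : ℕ, i < m → x n m α hq ^ i * g n m α hq ^ j ∈ Submodule.span ℂ S := by
    intro i j hi
    rw [pow_eq_pow_mod j (g_pow (hq := hq))]
    exact Submodule.subset_span ⟨(⟨i, hi⟩, ⟨j % n, Nat.mod_lt _ (NeZero.pos n)⟩), rfl⟩
  have hstep : ∀ a b : GenTaft n m α hq, b ∈ Submodule.span ℂ S → a * b ∈ Submodule.span ℂ S := by
    intro a b hb
    induction a using induction generalizing b with
    | h0 r => rw [← Algebra.smul_def]; exact Submodule.smul_mem _ _ hb
    | hadd a b ha hb' => rw [add_mul]; exact add_mem (ha _ hb) (hb' _ hb)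
    | hmul a b ha hb' => rw [mul_assoc]; exact ha _ (hb' _ hb)
    | hx =>
      induction hb using Submodule.span_induction with
      | mem b hb =>
        obtain ⟨⟨i, j⟩, rfl⟩ := hb
        simp only
        rw [← mul_assoc, ← pow_succ']
        rcases Nat.lt_or_ge (i + 1 : ℕ) m with h | h
        · exact key _ _ h
        · have hi : (i + 1 : ℕ) = m := by omega
          rw [hi, x_pow, smul_mul_assoc, sub_mul, one_mul, ← pow_add]
          have h0 := fun j => key 0 j (NeZero.pos m)
          simp only [pow_zero, one_mul] at h0
          exact Submodule.smul_mem _ _ (sub_mem (h0 _) (h0 _))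
      | zero => simp
      | add a b _ _ ha hb => rw [mul_add]; exact add_mem ha hb
      | smul r a _ ha => rw [mul_smul_comm]; exact Submodule.smul_mem _ _ ha
    | hg =>
      induction hb using Submodule.span_induction with
      | mem b hb =>
        obtain ⟨⟨i, j⟩, rfl⟩ := hb
        have h1 := pow_mul_pow_of_qcomm (g_mul_x (n := n) (m := m) (α := α) (hq := hq)) 1 i
        rw [pow_one, pow_one] at h1
        simp only
        rw [← mul_assoc, h1, smul_mul_assoc, mul_assoc, ← pow_succ']
        exact Submodule.smul_mem _ _ (key _ _ i.2)
      | zero => simp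
      | add a b _ _ ha hb => rw [mul_add]; exact add_mem ha hb
      | smul r a _ ha => rw [mul_smul_comm]; exact Submodule.smul_mem _ _ ha
  refine Submodule.eq_top_iff'.2 fun a => ?_
  have h1 : (1 : GenTaft n m α hq) ∈ Submodule.span ℂ S := by simpa using key 0 0 (NeZero.pos m)
  simpa using hstep a 1 h1

theorem isGroupLikeElem_g [NeZero m] : IsGroupLikeElem ℂ (g n m α hq) :=
  ⟨counit_g, comul_g⟩

section BialgHom

variable [NeZero n] [NeZero m] {K : Type*} [Ring K] [Bialgebra ℂ K] (π : GenTaft n m α hq →ₐc[ℂ] K)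

theorem linearIndependent_map (hg : Function.Injective fun j : Fin n => π (g n m α hq) ^ (j : ℕ))
    (hx : 1 < m → π (x n m α hq) ≠ 0) :
    LinearIndependent ℂ fun p : Fin m × Fin n =>
      π (x n m α hq ^ (p.1 : ℕ) * g n m α hq ^ (p.2 : ℕ)) := by
  simp only [map_mul, map_pow]
  refine linearIndependent_skewPrimitive_mul_groupLike (NeZero.pos n)
    (Nat.cast_ne_zero.2 (NeZero.ne m)) hq ?_ ?_ (isGroupLikeElem_g.map π) hg ?_ hx
  · rw [← map_mul, g_mul_x, map_smul, map_mul]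
  · rw [← map_pow, g_pow, map_one]
  · rw [← CoalgHomClass.map_comp_comul_apply, comul_x, map_add, TensorProduct.map_tmul,
      TensorProduct.map_tmul]
    simp

/-- The monomials span T and their images are independent, so nothing is lost under a bialgebra map.
-/
theorem injective_of_injective_pow
    (hg : Function.Injective fun j : Fin n => π (g n m α hq) ^ (j : ℕ))
    (hx : 1 < m → π (x n m α hq) ≠ 0) : Function.Injective π := by
  have h := linearIndependent_map π hg hx
  refine (injective_iff_map_eq_zero π).2 fun a ha => ?_
  have h1 : a ∈ Submodule.span ℂ (Set.range fun p : Fin m × Fin n =>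
      x n m α hq ^ (p.1 : ℕ) * g n m α hq ^ (p.2 : ℕ)) := by
    rw [span_x_pow_mul_g_pow]; trivial
  obtain ⟨f, rfl⟩ := (Submodule.mem_span_range_iff_exists_fun ℂ).1 h1
  rw [map_sum] at ha
  simp only [map_smul] at ha
  have h2 := Fintype.linearIndependent_iff.1 h f ha
  simp [h2]

end BialgHom

/-- The two hypotheses exclude a collapse of the presentation; they are supplied by a representation
in `finrank_eq_of_hopfAction`. -/
theorem finrank_eq [NeZero n] [NeZero m]
    (hg : Function.Injective fun j : Fin n => g n m α hq ^ (j : ℕ))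
    (hx : 1 < m → x n m α hq ≠ 0) : Module.finrank ℂ (GenTaft n m α hq) = n * m := by
  have h := linearIndependent_map (BialgHom.id ℂ (GenTaft n m α hq)) hg hx
  let b := Module.Basis.mk h (by rw [← span_x_pow_mul_g_pow]; rfl)
  rw [Module.finrank_eq_card_basis b]
  simp [mul_comm]

end GenTaft

theorem strongRankCondition_of_isUnit {A : Type*} [Ring A] [Nontrivial A]
    (hA : ∀ a : A, a ≠ 0 → IsUnit a) : StrongRankCondition A :=
  letI : DivisionRing A := DivisionRing.ofIsUnitOrEqZero fun a => or_iff_not_imp_right.2 (hA a)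
  inferInstance

namespace GenTaft

variable {n m : ℕ} {α q : ℂ} {hq : IsPrimitiveRoot q m} [NeZero n] [NeZero m]
  {A : Type*} [Ring A] [Algebra ℂ A]

/-- A module algebra structure over `T(n, m, α)` from an automorphism `G` and a skew derivation
`X`. -/
def hopfAction (X G : Module.End ℂ A) (h₁ : X ^ m = α • (1 - G ^ m)) (h₂ : G ^ n = 1)
    (h₃ : G * X = q • (X * G)) (hG1 : G 1 = 1) (hG : ∀ a b, G (a * b) = G a * G b) (hX1 : X 1 = 0)
    (hX : ∀ a b, X (a * b) = X a * b + G a * X b) : HopfAction ℂ (GenTaft n m α hq) A where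
  act := lift X G h₁ h₂ h₃
  act_one h := by
    induction h using induction with
    | h0 r => simp [Algebra.algebraMap_eq_smul_one]
    | hx => simp [hX1, counit_x]
    | hg => simp [hG1, counit_g]
    | hadd a b ha hb => simp [ha, hb]
    | hmul a b ha hb =>
      rw [map_mul, Module.End.mul_apply, hb, Algebra.algebraMap_eq_smul_one, map_smul, ha,
        Bialgebra.counit_mul, Algebra.algebraMap_eq_smul_one, smul_smul, mul_comm,
        Algebra.algebraMap_eq_smul_one]
  act_mul h a b := by
    set ρ : GenTaft n m α hq →ₐ[ℂ] Module.End ℂ A := lift X G h₁ h₂ h₃ with hρ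
    let Ψ : GenTaft n m α hq ⊗[ℂ] GenTaft n m α hq →ₐ[ℂ] Module.End ℂ (A ⊗[ℂ] A) :=
      (Module.endTensorEndAlgHom (R := ℂ) (S := ℂ) (A := ℂ) (M := A) (N := A)).comp
        (Algebra.TensorProduct.map ρ ρ)
    have hΨ : ∀ (u : GenTaft n m α hq ⊗[ℂ] GenTaft n m α hq) (a b : A), Ψ u (a ⊗ₜ b) =
        TensorProduct.map (ρ.toLinearMap.flip a) (ρ.toLinearMap.flip b) u := by
      intro u a b
      induction u with
      | zero => simp
      | add u v hu hv => simp only [map_add, LinearMap.add_apply, hu, hv]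
      | tmul u v => simp [Ψ, Module.endTensorEndAlgHom_apply]
    -- Stated for all tensors z, the compatibility with multiplication passes to products in h, so
    -- the generators suffice.
    have key : ∀ (h : GenTaft n m α hq) (z : A ⊗[ℂ] A), ρ h (LinearMap.mul' ℂ A z) =
        LinearMap.mul' ℂ A (Ψ (Coalgebra.comul h) z) := by
      intro h
      induction h using induction with
      | h0 r =>
        intro z
        have : Coalgebra.comul (R := ℂ) (algebraMap ℂ (GenTaft n m α hq) r) =
          algebraMap ℂ _ r := Bialgebra.comul_algebraMap r
        rw [this, AlgHom.commutes, AlgHom.commutes, Module.algebraMap_end_apply,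
          Module.algebraMap_end_apply, map_smul]
      | hx =>
        intro z
        induction z with
        | zero => simp
        | add z w hz hw => simp only [map_add, hz, hw]
        | tmul a b => simp [hΨ, comul_x, hρ, hX]
      | hg =>
        intro z
        induction z with
        | zero => simp
        | add z w hz hw => simp only [map_add, hz, hw]
        | tmul a b => simp [hΨ, comul_g, hρ, hG]
      | hadd h h' ih ih' => intro z; simp only [map_add, LinearMap.add_apply, ih, ih']
      | hmul h h' ih ih' =>
        intro z
        rw [map_mul, Module.End.mul_apply, ih', ih, Bialgebra.comul_mul, map_mul,
          Module.End.mul_apply]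
    rw [← hΨ, ← key, LinearMap.mul'_apply]

theorem act_hopfAction_x (X G : Module.End ℂ A) (h₁ h₂ h₃ hG1 hG hX1 hX) :
    (hopfAction (n := n) (m := m) (α := α) (hq := hq) X G h₁ h₂ h₃ hG1 hG hX1 hX).act
      (x n m α hq) = X :=
  lift_x X G h₁ h₂ h₃

theorem act_hopfAction_g (X G : Module.End ℂ A) (h₁ h₂ h₃ hG1 hG hX1 hX) :
    (hopfAction (n := n) (m := m) (α := α) (hq := hq) X G h₁ h₂ h₃ hG1 hG hX1 hX).act
      (g n m α hq) = G :=
  lift_g X G h₁ h₂ h₃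

theorem mem_invariants_iff (ρ : HopfAction ℂ (GenTaft n m α hq) A) (a : A) :
    a ∈ ρ.invariants ↔ ρ.act (g n m α hq) a = a ∧ ρ.act (x n m α hq) a = 0 := by
  constructor
  · intro h
    have hg := h (g n m α hq)
    have hx := h (x n m α hq)
    rw [counit_g, one_smul] at hg
    rw [counit_x, zero_smul] at hx
    exact ⟨hg, hx⟩
  · rintro ⟨hg, hx⟩ h
    induction h using induction with
    | h0 r => simp
    | hx => rw [hx, counit_x, zero_smul]
    | hg => rw [hg, counit_g, one_smul]
    | hadd h h' ih ih' => rw [map_add, LinearMap.add_apply, ih, ih', map_add, add_smul]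
    | hmul h h' ih ih' =>
      rw [map_mul, Module.End.mul_apply, ih', map_smul, ih, Bialgebra.counit_mul, smul_smul, mul_comm]

/-- If the action factors through K, a coincidence of powers of g in K, or the vanishing of x there,
would already be seen in the action. -/
theorem isInnerFaithful (ρ : HopfAction ℂ (GenTaft n m α hq) A)
    (hg : Function.Injective fun j : Fin n => ρ.act (g n m α hq) ^ (j : ℕ))
    (hx : 1 < m → ρ.act (x n m α hq) ≠ 0) : ρ.IsInnerFaithful := by
  intro K _ _ π _ ⟨τ, hτ⟩
  refine injective_of_injective_pow π (fun i j hij => hg ?_) fun hm h0 => hx hm ?_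
  · have h1 := congrArg τ hij
    simpa only [map_pow, ← hτ] using h1
  · rw [hτ, h0, map_zero]

theorem finrank_eq_of_hopfAction (ρ : HopfAction ℂ (GenTaft n m α hq) A)
    (hg : Function.Injective fun j : Fin n => ρ.act (g n m α hq) ^ (j : ℕ))
    (hx : 1 < m → ρ.act (x n m α hq) ≠ 0) : Module.finrank ℂ (GenTaft n m α hq) = n * m := by
  refine finrank_eq (fun i j hij => hg ?_) fun hm h0 => hx hm ?_
  · have h1 := congrArg ρ.act hij
    simpa only [map_pow] using h1
  · rw [h0, map_zero]

end GenTaft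

/-! ### Invariants of a division algebra, and a rank obstruction to being Hopf-Galois -/

namespace HopfAction

variable {k H A : Type*} [Field k] [Ring H] [HopfAlgebra k H] [Ring A] [Algebra k A]

theorem inv_mem_invariants (ρ : HopfAction k H A) (u : Aˣ) (hu : (u : A) ∈ ρ.invariants) :
    (↑u⁻¹ : A) ∈ ρ.invariants := by
  intro h
  have h1 := ρ.act_mul_of_mem hu h (↑u⁻¹ : A)
  rw [Units.mul_inv, ρ.act_one, Algebra.algebraMap_eq_smul_one] at h1
  rw [← u.inv_mul_cancel_left (ρ.act h _), ← h1, mul_smul_comm, mul_one]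

theorem isUnit_invariants (ρ : HopfAction k H A) (hA : ∀ a : A, a ≠ 0 → IsUnit a)
    (e : ρ.invariants) (he : e ≠ 0) : IsUnit e := by
  obtain ⟨u, hu⟩ := hA e fun h0 => he (Subtype.ext h0)
  have hinv : (↑u⁻¹ : A) ∈ ρ.invariants := ρ.inv_mem_invariants u (hu ▸ e.2)
  exact ⟨⟨e, ⟨_, hinv⟩, Subtype.ext (by simp [← hu]), Subtype.ext (by simp [← hu])⟩, rfl⟩

/-- The coaction is left linear over the invariants, so the image of the Galois map lies in the left
A-span of the δ(w_i). These are fewer than dim H, the rank of the free module A ⊗ H* over A. -/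
theorem not_isHopfGalois [Module.Finite k H] [StrongRankCondition A] (ρ : HopfAction k H A)
    {ι : Type*} [Fintype ι] (w : ι → A)
    (hw : ⊤ ≤ Submodule.span ρ.invariants (Set.range w)) (hcard : Fintype.card ι < Module.finrank k H) :
    ¬ ρ.IsHopfGalois := by
  intro hgal
  have hsmul : ∀ (a : A) (z : A ⊗[k] Module.Dual k H),
      (LinearMap.mulLeft k a).rTensor (Module.Dual k H) z = a • z := by
    intro a z
    induction z with
    | zero => simp
    | add z w hz hw => rw [map_add, hz, hw, smul_add]
    | tmul b f => rfl
  have h1 : ∀ a : A, ρ.coaction a ∈ Submodule.span A (Set.range fun i => ρ.coaction (w i)) := by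
    intro a
    have ha : a ∈ Submodule.span ρ.invariants (Set.range w) := hw trivial
    induction ha using Submodule.span_induction with
    | mem a ha =>
      obtain ⟨i, rfl⟩ := ha
      exact Submodule.subset_span ⟨i, rfl⟩
    | zero => rw [map_zero]; exact zero_mem _
    | add a b _ _ ha hb => rw [map_add]; exact add_mem ha hb
    | smul e a _ ha =>
      have : ρ.coaction (e • a) = (e : A) • ρ.coaction a := by
        rw [← hsmul, ← ρ.coaction_mul_of_mem e.2]; rfl
      rw [this]
      exact Submodule.smul_mem _ _ ha
  have h2 : ∀ u : A ⊗[k] A,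
      ρ.preGaloisMap u ∈ Submodule.span A (Set.range fun i => ρ.coaction (w i)) := by
    intro u
    induction u with
    | zero => rw [map_zero]; exact zero_mem _
    | add u v hu hv => rw [map_add]; exact add_mem hu hv
    | tmul a b =>
      rw [preGaloisMap_tmul, hsmul]
      exact Submodule.smul_mem _ _ (h1 b)
  have h3 : ⊤ ≤ Submodule.span A (Set.range fun i => ρ.coaction (w i)) := by
    intro z _
    obtain ⟨u, rfl⟩ := hgal.2 z
    obtain ⟨u, rfl⟩ := Submodule.mkQ_surjective _ u
    exact h2 u
  let b := Algebra.TensorProduct.basis A (Module.finBasis k (Module.Dual k H))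
  have h4 := finrank_range_le_card (R := A) fun i => ρ.coaction (w i)
  rw [Set.finrank, top_le_iff.1 h3, finrank_top, Module.finrank_eq_card_basis b, Fintype.card_fin,
    Subspace.dual_finrank_eq] at h4
  omega

end HopfAction

/-! ### Rank over a fixed ring -/

section Eigen

/-- An algebra with an automorphism `γ` of order dividing `n` and a unit `t` with `γ t = ζ t` is
free over the fixed points of `γ`, with basis `1, t, …, t ^ (n - 1)`. -/
theorem exists_basis_pow_of_eigenvector {k A : Type*} [Field k] [Ring A] [Algebra k A] {n : ℕ}
    (hn : (n : k) ≠ 0) {ζ : k} (hζ : IsPrimitiveRoot ζ n) (γ : A →ₐ[k] A)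
    (hγ : γ ^ n = 1) (t : Aˣ) (ht : γ t = ζ • (t : A)) (E : Subalgebra k A)
    (hE : ∀ a, a ∈ E ↔ γ a = a) :
    ∃ b : Module.Basis (Fin n) E A, ∀ i, b i = (t : A) ^ (i : ℕ) := by
  have hn0 : n ≠ 0 := by rintro rfl; simp at hn
  have hζ0 : ζ ≠ 0 := hζ.ne_zero hn0
  have htp : ∀ i : ℕ, γ ((t : A) ^ i) = ζ ^ i • (t : A) ^ i := by
    intro i
    rw [map_pow, ht, smul_pow]
  -- `P r` is n times the projection to the ζ^r-eigenspace of γ.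
  let P : ℕ → A →ₗ[k] A := fun r => ∑ l ∈ Finset.range n, (ζ⁻¹ ^ r) ^ l • (γ ^ l).toLinearMap
  have hpow : ∀ (l : ℕ) (e : A) (i : ℕ), γ e = e →
      (γ ^ l) (e * (t : A) ^ i) = (ζ ^ i) ^ l • (e * (t : A) ^ i) := by
    intro l e i he
    induction l with
    | zero => simp
    | succ l ih =>
      rw [pow_succ', AlgHom.mul_apply, ih, map_smul, map_mul, he, htp, mul_smul_comm, smul_smul,
        ← pow_succ]
  have hP : ∀ (r i : ℕ), r < n → i < n → ∀ e : A, γ e = e →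
      P r (e * (t : A) ^ i) = if i = r then (n : k) • (e * (t : A) ^ i) else 0 := by
    intro r i hr hi e he
    simp only [P, LinearMap.sum_apply, LinearMap.smul_apply, AlgHom.toLinearMap_apply, hpow _ e i he,
      smul_smul, ← mul_pow]
    rw [← Finset.sum_smul]
    split_ifs with hir
    · subst hir
      rw [← mul_pow, inv_mul_cancel₀ hζ0]
      simp
    · have hz : ζ⁻¹ ^ r * ζ ^ i ≠ 1 := by
        intro h0
        apply hir
        apply hζ.pow_inj hi hr
        rw [inv_pow] at h0
        exact ((inv_mul_eq_one₀ (pow_ne_zero _ hζ0)).1 h0).symm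
      have h2 := geom_sum_mul (ζ⁻¹ ^ r * ζ ^ i) n
      have h3 : (ζ⁻¹ ^ r * ζ ^ i) ^ n = 1 := by
        rw [mul_pow, pow_right_comm, pow_right_comm ζ, inv_pow, hζ.pow_eq_one]
        simp
      rw [h3, sub_self] at h2
      rw [(mul_eq_zero.1 h2).resolve_right (sub_ne_zero.2 hz), zero_smul]
  have hγP : ∀ (r : ℕ) (a : A), γ (P r a) = ζ ^ r • P r a := by
    intro r a
    have h1 : ∀ l, γ ((γ ^ l) a) = (γ ^ (l + 1)) a := fun l => by rw [pow_succ', AlgHom.mul_apply]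
    simp only [P, LinearMap.sum_apply, LinearMap.smul_apply, AlgHom.toLinearMap_apply, map_sum,
      map_smul, h1]
    have h2 : ∀ l, (ζ⁻¹ ^ r) ^ l • (γ ^ (l + 1)) a =
        ζ ^ r • ((ζ⁻¹ ^ r) ^ (l + 1) • (γ ^ (l + 1)) a) := by
      intro l
      rw [smul_smul, pow_succ' (ζ⁻¹ ^ r), ← mul_assoc, ← mul_pow, mul_inv_cancel₀ hζ0,
        one_pow, one_mul]
    simp only [h2, ← Finset.smul_sum]
    congr 1
    -- Applying γ shifts the summation index by one; the terms l = n and l = 0 agree because γ^n = 1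
    -- and ζ^n = 1.
    have h3 := Finset.sum_range_succ' (fun l => (ζ⁻¹ ^ r) ^ l • (γ ^ l) a) n
    rw [Finset.sum_range_succ] at h3
    have h4 : (ζ⁻¹ ^ r) ^ n • (γ ^ n) a = (ζ⁻¹ ^ r) ^ 0 • (γ ^ 0) a := by
      rw [pow_right_comm, inv_pow, hζ.pow_eq_one, hγ]
      simp
    rw [h4] at h3
    exact (add_right_cancel h3).symm
  have hsum : ∀ a : A, ∑ r ∈ Finset.range n, P r a = (n : k) • a := by
    intro a
    simp only [P, LinearMap.sum_apply, LinearMap.smul_apply, AlgHom.toLinearMap_apply]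
    rw [Finset.sum_comm]
    simp only [← Finset.sum_smul]
    rw [Finset.sum_eq_single 0]
    · simp
    · intro l hl hl0
      have hl := Finset.mem_range.1 hl
      have h1 : ∀ r, (ζ⁻¹ ^ r) ^ l = (ζ⁻¹ ^ l) ^ r := fun r => pow_right_comm _ _ _
      simp only [h1]
      have hz : ζ⁻¹ ^ l ≠ 1 := by
        rw [inv_pow, inv_ne_one]
        exact hζ.pow_ne_one_of_pos_of_lt hl0 hl
      have h2 := geom_sum_mul (ζ⁻¹ ^ l) n
      rw [pow_right_comm, inv_pow ζ n, hζ.pow_eq_one, inv_one, one_pow, sub_self] at h2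
      rw [(mul_eq_zero.1 h2).resolve_right (sub_ne_zero.2 hz), zero_smul]
    · intro h0
      exact absurd (Finset.mem_range.2 (Nat.pos_of_ne_zero hn0)) h0
  have hli : LinearIndependent E fun i : Fin n => (t : A) ^ (i : ℕ) := by
    refine Fintype.linearIndependent_iff.2 fun e he r => ?_
    have h1 := congrArg (P r) he
    rw [map_zero, map_sum, Finset.sum_eq_single r] at h1
    · have h2 := hP r r r.2 r.2 (e r) ((hE _).1 (e r).2)
      rw [if_pos rfl] at h2
      have h3 : (n : k) • ((e r : A) * (t : A) ^ (r : ℕ)) = 0 := h2.symm.trans h1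
      have h4 := (smul_eq_zero_iff_right hn).1 h3
      rw [← Units.val_pow_eq_pow_val] at h4
      exact Subtype.ext ((Units.mul_left_eq_zero _).1 h4)
    · intro i _ hir
      have h2 := hP r i r.2 i.2 (e i) ((hE _).1 (e i).2)
      rw [if_neg (fun h => hir (Fin.ext h))] at h2
      exact h2
    · simp
  have hspan : ⊤ ≤ Submodule.span E (Set.range fun i : Fin n => (t : A) ^ (i : ℕ)) := by
    intro a _
    have h1 : a = ∑ r ∈ Finset.range n, (n : k)⁻¹ • P r a := by
      rw [← Finset.smul_sum, hsum, smul_smul, inv_mul_cancel₀ hn, one_smul]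
    rw [h1]
    refine sum_mem fun r hr => ?_
    have hr := Finset.mem_range.1 hr
    have hinv : γ (↑(t ^ r)⁻¹ : A) = ζ⁻¹ ^ r • (↑(t ^ r)⁻¹ : A) := by
      have h2 : γ (↑(t ^ r)⁻¹ : A) * γ ((t : A) ^ r) = 1 := by
        rw [← map_mul, ← Units.val_pow_eq_pow_val, Units.inv_mul, map_one]
      rw [htp, mul_smul_comm, ← Units.val_pow_eq_pow_val] at h2
      have h3 := congrArg (fun z => ζ⁻¹ ^ r • (z * (↑(t ^ r)⁻¹ : A))) h2
      simp only [smul_mul_assoc, Units.mul_inv_cancel_right, smul_smul, ← mul_pow,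
        inv_mul_cancel₀ hζ0, one_pow, one_smul, one_mul] at h3
      exact h3
    -- Dividing the ζ^r-component of a by t^r gives a fixed element, the coefficient of t^r.
    have he : (n : k)⁻¹ • P r a * (↑(t ^ r)⁻¹ : A) ∈ E := by
      rw [hE, map_mul, map_smul, hγP, hinv, mul_smul_comm, smul_comm, smul_mul_assoc, smul_smul,
        ← mul_pow, inv_mul_cancel₀ hζ0, one_pow, one_smul]
    have h5 : (n : k)⁻¹ • P r a = (⟨_, he⟩ : E) • (t : A) ^ r := by
      change _ = _ * (t : A) ^ r
      rw [← Units.val_pow_eq_pow_val, Units.inv_mul_cancel_right]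
    rw [h5]
    exact Submodule.smul_mem _ _ (Submodule.subset_span ⟨⟨r, hr⟩, rfl⟩)
  exact ⟨Module.Basis.mk hli hspan, fun i => Module.Basis.mk_apply hli hspan i⟩

end Eigen

/-! ### Inner skew derivations as actions of x -/

theorem neg_mul_pow_of_qcomm {R : Type*} [Ring R] [Algebra ℂ R] {q : ℂ} {m : ℕ} (hm : m ≠ 0)
    (hq : IsPrimitiveRoot q m) {a b : R} (h : b * a = q • (a * b)) :
    (-(a * b)) ^ m = -(a ^ m * b ^ m) := by
  have h1 : ((-1 : R) ^ m) = ((-1 : ℂ) ^ m) • 1 := by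
    rw [Algebra.smul_def, mul_one, map_pow, map_neg, map_one]
  rw [neg_pow, mul_pow_of_qcomm q _ _ h, h1, smul_mul_assoc, one_mul, smul_smul,
    neg_one_pow_mul_pow_triangle hm hq, neg_one_smul]

namespace GenTaft

/-- Put x = β(Λ - PG), with Λ and P left and right multiplication by c. Since Λ and -PG q-commute,
x^m = α(Λ^m + (-PG)^m), and the sign and power of q combine to (-PG)^m = -P^m G^m. The hypothesis
`hcm` then says exactly that x^m = α(1 - g^m). -/
theorem exists_hopfAction {n m : ℕ} {α q : ℂ} {hq : IsPrimitiveRoot q m} [NeZero n] [NeZero m]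
    {A : Type*} [Ring A] [Algebra ℂ A] (γ : A →ₐ[ℂ] A) (hγ : γ ^ n = 1) (c : A)
    (hc : γ c = q • c) (hcm : ∀ a, c ^ m * a - (γ ^ m) a * c ^ m = a - (γ ^ m) a) (β : ℂ)
    (hβ : β ^ m = α) :
    ∃ ρ : HopfAction ℂ (GenTaft n m α hq) A, (∀ a, ρ.act (g n m α hq) a = γ a) ∧
      ∀ a, ρ.act (x n m α hq) a = β • (c * a - γ a * c) := by
  let G : Module.End ℂ A := γ.toLinearMap
  let Λ : Module.End ℂ A := LinearMap.mulLeft ℂ c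
  let P : Module.End ℂ A := LinearMap.mulRight ℂ c
  have hGP : G * P = q • (P * G) := by
    ext a
    simp [G, P, hc]
  have hpow : ∀ (l : ℕ) (a : A), (G ^ l) a = (γ ^ l) a := by
    intro l
    induction l with
    | zero => simp
    | succ l ih => intro a; rw [pow_succ, Module.End.mul_apply, ih, pow_succ, AlgHom.mul_apply]; rfl
  have hPΛ : -(P * G) * Λ = q • (Λ * -(P * G)) := by
    ext a
    simp [G, P, Λ, hc, mul_assoc]
  have hN : (-(P * G)) ^ m = -(P ^ m * G ^ m) := neg_mul_pow_of_qcomm (NeZero.ne m) hq hGP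
  have hΛ : ∀ a, (Λ ^ m) a = c ^ m * a := fun a => by
    rw [LinearMap.pow_mulLeft]; rfl
  have hP : ∀ a, (P ^ m) a = a * c ^ m := fun a => by
    rw [LinearMap.pow_mulRight]; rfl
  have h₁ : (β • (Λ + -(P * G))) ^ m = α • (1 - G ^ m) := by
    rw [smul_pow, hβ, add_pow_of_isPrimitiveRoot (NeZero.ne m) hq _ _ hPΛ, hN]
    congr 1
    ext a
    change (Λ ^ m) a + -((P ^ m) ((G ^ m) a)) = a - (G ^ m) a
    rw [hΛ, hP, hpow, ← hcm, sub_eq_add_neg]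
  have h₂ : G ^ n = 1 := by
    ext a
    rw [hpow, hγ]
    rfl
  have h₃ : G * (β • (Λ + -(P * G))) = q • (β • (Λ + -(P * G)) * G) := by
    ext a
    simp [G, P, Λ, hc, smul_smul, mul_comm]
  have hX1 : (β • (Λ + -(P * G))) 1 = 0 := by simp [G, P, Λ]
  have hX : ∀ a b, (β • (Λ + -(P * G))) (a * b) =
      (β • (Λ + -(P * G))) a * b + G a * (β • (Λ + -(P * G))) b := by
    intro a b
    simp [G, P, Λ, mul_add, add_mul, smul_add, mul_assoc]
  have hG1 : G 1 = 1 := map_one γ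
  have hGm : ∀ a b, G (a * b) = G a * G b := map_mul γ
  refine ⟨hopfAction _ G h₁ h₂ h₃ hG1 hGm hX1 hX, fun a => ?_, fun a => ?_⟩
  · rw [act_hopfAction_g]
    rfl
  · rw [act_hopfAction_x]
    simp [G, P, Λ, sub_eq_add_neg]

end GenTaft

/-! ### Centralizers and scaling endomorphisms of the Ore extension and its fractions -/

namespace OreExt

variable {k L : Type*} [Field k] [Field L] [Algebra k L] (σ : L ≃ₐ[k] L)

theorem coeff_C_mul (a : L) (r : OreExt σ) (i : ℕ) : coeff σ (C σ a * r) i = a * coeff σ r i := by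
  induction r using induction with
  | h0 => simp [coeff]
  | hadd r r' h h' => rw [mul_add, coeff_add, coeff_add, h, h', mul_add]
  | hmon b j => rw [← mul_assoc, ← map_mul, coeff_C_mul_t_pow, coeff_C_mul_t_pow, mul_ite, mul_zero]

theorem coeff_mul_C (a : L) (r : OreExt σ) (i : ℕ) :
    coeff σ (r * C σ a) i = coeff σ r i * (σ.symm ^ i) a := by
  induction r using induction with
  | h0 => simp [coeff]
  | hadd r r' h h' => rw [add_mul, coeff_add, coeff_add, h, h', add_mul]
  | hmon b j =>
    rw [mul_assoc, t_pow_mul_C, ← mul_assoc, ← map_mul, coeff_C_mul_t_pow, coeff_C_mul_t_pow, ite_mul,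
      zero_mul]
    split_ifs with h
    · rw [h]
    · rfl

/-- If `y` is fixed by no more powers of `σ` than all of `L`, then the centralizer of `y` in
`L[t; σ]` is contained in the centralizer of `L`. -/
theorem commute_C_of_commute_C {y : L} (hy : ∀ i : ℕ, (σ.symm ^ i) y = y → σ.symm ^ i = 1)
    {r : OreExt σ} (hr : C σ y * r = r * C σ y) (a : L) : C σ a * r = r * C σ a := by
  refine ext_coeff σ fun i => ?_
  have h1 := congrArg (fun z => coeff σ z i) hr
  simp only [coeff_C_mul, coeff_mul_C] at h1 ⊢
  -- A nonzero coefficient of t^i cancels from the relation, so σ^(-i) fixes y and is therefore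
  -- trivial on L.
  rcases eq_or_ne (coeff σ r i) 0 with h0 | h0
  · simp [h0]
  · rw [mul_comm] at h1
    rw [hy i (mul_left_cancel₀ h0 h1).symm, mul_comm]
    rfl

/-- The endomorphism of `L[t; σ]` that extends `γ` and multiplies `t` by the scalar `ζ`. -/
def scale (γ : L ≃ₐ[k] L) (hγ : ∀ a, γ (σ a) = σ (γ a)) (ζ : k) : OreExt σ →+* OreExt σ :=
  lift σ ((C σ).comp (γ : L →+* L)) (C σ (algebraMap k L ζ) * t σ) fun a => by
    simp only [RingHom.comp_apply, RingHom.coe_coe]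
    rw [← mul_assoc, mul_assoc _ (t σ), hγ, ← C_mul_t, ← mul_assoc, ← map_mul, ← map_mul, mul_comm]

section scale

variable (γ : L ≃ₐ[k] L) (hγ : ∀ a, γ (σ a) = σ (γ a)) (ζ : k)

theorem scale_C (a : L) : scale σ γ hγ ζ (C σ a) = C σ (γ a) := lift_C ..

theorem scale_t : scale σ γ hγ ζ (t σ) = C σ (algebraMap k L ζ) * t σ := lift_t ..

theorem scale_pow_eq_one {n : ℕ} (hn : γ ^ n = 1) (hζ : ζ ^ n = 1) : scale σ γ hγ ζ ^ n = 1 := by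
  have hC : ∀ (l : ℕ) (a : L), (scale σ γ hγ ζ ^ l) (C σ a) = C σ ((γ ^ l) a) := by
    intro l
    induction l with
    | zero => intro a; rfl
    | succ l ih =>
      intro a
      rw [pow_succ, RingHom.mul_def, RingHom.comp_apply, scale_C, ih, pow_succ, AlgEquiv.mul_apply]
  have ht : ∀ l : ℕ, (scale σ γ hγ ζ ^ l) (t σ) = C σ (algebraMap k L (ζ ^ l)) * t σ := by
    intro l
    induction l with
    | zero => simp
    | succ l ih =>
      rw [pow_succ, RingHom.mul_def, RingHom.comp_apply, scale_t, map_mul, ih, hC, AlgEquiv.commutes,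
        ← mul_assoc, ← map_mul, ← map_mul, ← pow_succ']
  refine ringHom_ext σ (fun a => ?_) ?_
  · rw [hC, hn]; rfl
  · rw [ht, hζ, map_one, map_one, one_mul]; rfl

/-- Finite order provides a left inverse. Injectivity is what lets the endomorphism extend to
fractions: denominators go to nonzero elements, which are invertible there. -/
theorem scale_injective {n : ℕ} (hn0 : n ≠ 0) (hn : γ ^ n = 1) (hζ : ζ ^ n = 1) :
    Function.Injective (scale σ γ hγ ζ) := by
  have h := scale_pow_eq_one σ γ hγ ζ hn hζ
  obtain ⟨l, rfl⟩ := Nat.exists_eq_succ_of_ne_zero hn0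
  refine Function.HasLeftInverse.injective ⟨(scale σ γ hγ ζ ^ l : OreExt σ →+* OreExt σ), fun r => ?_⟩
  have h1 := DFunLike.congr_fun h r
  rwa [Nat.succ_eq_add_one, pow_succ] at h1

end scale

end OreExt

section OreFrac

open OreExt CenterFrac

variable {k L : Type*} [Field k] [Field L] [Algebra k L] (σ : L ≃ₐ[k] L)

theorem CenterFrac.algebraMap_eq (r : k) :
    algebraMap k (CenterFrac (OreExt σ)) r = num (C σ (algebraMap k L r)) := rfl

theorem CenterFrac.algHom_ext {A : Type*} [Ring A] [Algebra k A] {f f' : CenterFrac (OreExt σ) →ₐ[k] A}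
    (h : ∀ r, f (num r) = f' (num r)) : f = f' := by
  have h1 : (f : CenterFrac (OreExt σ) →+* A) = f' := CenterFrac.ringHom_ext h
  exact AlgHom.ext fun a => DFunLike.congr_fun h1 a

/-- An identity `z a = φ(a) z` for an endomorphism `φ` holds for all `a` if it holds for `a` in `L`
and for `a = t`. -/
theorem CenterFrac.semiconj_ext {φ : CenterFrac (OreExt σ) →+* CenterFrac (OreExt σ)}
    {z : CenterFrac (OreExt σ)} (hC : ∀ a, z * num (C σ a) = φ (num (C σ a)) * z)
    (ht : z * num (t σ) = φ (num (t σ)) * z) (a : CenterFrac (OreExt σ)) : z * a = φ a * z := by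
  have hnum : ∀ r : OreExt σ, z * num r = φ (num r) * z := by
    intro r
    induction r using OreExt.induction with
    | h0 => simp
    | hadd r r' h h' => simp only [map_add, mul_add, add_mul, h, h']
    | hmon a i =>
      have hti : z * num (t σ) ^ i = φ (num (t σ)) ^ i * z := by
        induction i with
        | zero => simp
        | succ i ih => rw [pow_succ, ← mul_assoc, ih, mul_assoc, ht, ← mul_assoc, ← pow_succ]
      rw [map_mul, map_pow, ← mul_assoc, hC, mul_assoc, hti, ← mul_assoc, map_mul, map_pow]
  obtain ⟨r, s, hr⟩ := exists_rep a
  refine ((isUnit_num s).map φ).mul_left_cancel ?_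
  rw [← mul_assoc, ← hnum, mul_assoc, hr, hnum, ← mul_assoc, ← map_mul, hr]

/-- Clearing a central denominator reduces this to the Ore extension. -/
theorem CenterFrac.commute_C_of_commute_C {y : L}
    (hy : ∀ i : ℕ, (σ.symm ^ i) y = y → σ.symm ^ i = 1)
    {z : CenterFrac (OreExt σ)} (hz : num (C σ y) * z = z * num (C σ y)) (a : L) :
    num (C σ a) * z = z * num (C σ a) := by
  obtain ⟨r, s, hr⟩ := exists_rep z
  have hs : ∀ w, w * num (s : OreExt σ) = num (s : OreExt σ) * w :=
    Subring.mem_center_iff.1 (num_central s)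
  have h1 : C σ y * r = r * C σ y := by
    apply num_injective
    rw [map_mul, map_mul, ← hr, ← mul_assoc, hs, mul_assoc, hz, mul_assoc]
  have h2 := congrArg num (OreExt.commute_C_of_commute_C σ hy h1 a)
  rw [map_mul, map_mul, ← hr, ← mul_assoc, hs, mul_assoc, mul_assoc] at h2
  exact (isUnit_num s).mul_left_cancel h2

variable [Module.Finite (Subring.center (OreExt σ)) (OreExt σ)]
  (γ : L ≃ₐ[k] L) (hγ : ∀ a, γ (σ a) = σ (γ a)) (ζ : k) {n : ℕ} (hn0 : n ≠ 0) (hn : γ ^ n = 1)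
  (hζ : ζ ^ n = 1)

/-- The endomorphism of `Frac(L[t; σ])` that extends `γ` and multiplies `t` by the scalar `ζ`. -/
def CenterFrac.scale : CenterFrac (OreExt σ) →ₐ[k] CenterFrac (OreExt σ) where
  toRingHom := CenterFrac.lift (num.comp (OreExt.scale σ γ hγ ζ)) fun s =>
    isUnit_num_of_ne_zero fun h0 => nonZeroDivisors.ne_zero s.2.2
      (OreExt.scale_injective σ γ hγ ζ hn0 hn hζ (h0.trans (map_zero _).symm))
  commutes' r := by
    rw [CenterFrac.algebraMap_eq]
    change CenterFrac.lift _ _ (num _) = _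
    rw [CenterFrac.lift_num, RingHom.comp_apply, OreExt.scale_C, AlgEquiv.commutes]

theorem CenterFrac.scale_num (r : OreExt σ) :
    CenterFrac.scale σ γ hγ ζ hn0 hn hζ (num r) = num (OreExt.scale σ γ hγ ζ r) :=
  CenterFrac.lift_num _ _ _

theorem CenterFrac.scale_C (a : L) :
    CenterFrac.scale σ γ hγ ζ hn0 hn hζ (num (C σ a)) = num (C σ (γ a)) := by
  rw [CenterFrac.scale_num, OreExt.scale_C]

theorem CenterFrac.scale_t :
    CenterFrac.scale σ γ hγ ζ hn0 hn hζ (num (t σ)) = ζ • num (t σ) := by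
  rw [CenterFrac.scale_num, OreExt.scale_t, map_mul, ← CenterFrac.algebraMap_eq, Algebra.smul_def]

theorem CenterFrac.scale_pow_num (l : ℕ) (r : OreExt σ) :
    (CenterFrac.scale σ γ hγ ζ hn0 hn hζ ^ l) (num r) = num ((OreExt.scale σ γ hγ ζ ^ l) r) := by
  induction l generalizing r with
  | zero => rfl
  | succ l ih => rw [pow_succ, AlgHom.mul_apply, scale_num, ih, pow_succ]; rfl

theorem CenterFrac.scale_pow_eq_one : CenterFrac.scale σ γ hγ ζ hn0 hn hζ ^ n = 1 := by
  refine CenterFrac.algHom_ext σ fun r => ?_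
  rw [scale_pow_num, OreExt.scale_pow_eq_one σ γ hγ ζ hn hζ]
  rfl

end OreFrac

theorem AlgEquiv.restrictScalars_pow_apply {k F L : Type*} [Field k] [Field F] [Field L]
    [Algebra k F] [Algebra F L] [Algebra k L] [IsScalarTower k F L] (σ : L ≃ₐ[F] L) (i : ℕ) (a : L) :
    (σ.restrictScalars k ^ i) a = (σ ^ i) a := by
  induction i generalizing a with
  | zero => rfl
  | succ i ih => rw [pow_succ, AlgEquiv.mul_apply, ih, pow_succ, AlgEquiv.mul_apply]; rfl

theorem AlgEquiv.restrictScalars_pow_eq_one (k : Type*) {F L : Type*} [Field k] [Field F] [Field L]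
    [Algebra k F] [Algebra F L] [Algebra k L] [IsScalarTower k F L] {σ : L ≃ₐ[F] L} {i : ℕ}
    (h : σ ^ i = 1) : σ.restrictScalars k ^ i = 1 :=
  AlgEquiv.ext fun a => by rw [restrictScalars_pow_apply, h]; rfl

/-! ### The action of T on Q -/

namespace IsRootSystem

open Polynomial CenterFrac

variable {L : Type*} [Field L] [Algebra (RatFunc ℂ) L] [Algebra ℂ L]
  [IsScalarTower ℂ (RatFunc ℂ) L] {n m : ℕ} [NeZero n] [NeZero m] {q ζ : ℂ} {y : L}
  {c : ZMod (n / m) → L}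

theorem isGalois (n m : ℕ) [IsSplittingField (RatFunc ℂ) L (taftPoly n m)] :
    IsGalois (RatFunc ℂ) L :=
  have := IsSplittingField.finiteDimensional (K := RatFunc ℂ) L (taftPoly n m)
  have := Normal.of_isSplittingField (F := RatFunc ℂ) (E := L) (taftPoly n m)
  { }

/-- The automorphism that multiplies every `c j` by `q`. -/
theorem exists_scale [IsSplittingField (RatFunc ℂ) L (taftPoly n m)] (hmn : m ∣ n)
    (hq : IsPrimitiveRoot q m) (hζ : IsPrimitiveRoot ζ n) (h : IsRootSystem n m ζ y c) :
    ∃ γ : L ≃ₐ[RatFunc ℂ] L, ∀ j, γ (c j) = algebraMap ℂ L q * c j := by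
  have := IsSplittingField.finiteDimensional (K := RatFunc ℂ) L (taftPoly n m)
  have := isGalois (L := L) n m
  obtain ⟨k, hk, hkq⟩ := hq.eq_pow_of_pow_eq_one hq.pow_eq_one
  obtain ⟨γ, hγ⟩ := h.exists_algEquiv_mul hmn hq hζ fun _ => ⟨k, hk⟩
  exact ⟨γ, fun j => by rw [hγ, hkq]⟩

theorem scale_pow [IsSplittingField (RatFunc ℂ) L (taftPoly n m)] (hmn : m ∣ n)
    (hq : IsPrimitiveRoot q m) (hζ : IsPrimitiveRoot ζ n) (h : IsRootSystem n m ζ y c)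
    {γ : L ≃ₐ[RatFunc ℂ] L} (hγ : ∀ j, γ (c j) = algebraMap ℂ L q * c j) : γ ^ m = 1 := by
  refine h.algEquiv_ext hmn hq hζ fun j => ?_
  have h1 : ∀ k : ℕ, (γ ^ k) (c j) = algebraMap ℂ L (q ^ k) * c j := by
    intro k
    induction k with
    | zero => simp
    | succ k ih =>
      rw [pow_succ', AlgEquiv.mul_apply, ih, map_mul, hγ,
        IsScalarTower.algebraMap_apply ℂ (RatFunc ℂ) L, AlgEquiv.commutes, ← mul_assoc,
        IsScalarTower.algebraMap_apply ℂ (RatFunc ℂ) L q, ← map_mul, ← map_mul, ← pow_succ,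
        ← IsScalarTower.algebraMap_apply]
  rw [h1, hq.pow_eq_one, map_one, one_mul]
  rfl

theorem scale_comm [IsSplittingField (RatFunc ℂ) L (taftPoly n m)] (hmn : m ∣ n)
    (hq : IsPrimitiveRoot q m) (hζ : IsPrimitiveRoot ζ n) (h : IsRootSystem n m ζ y c)
    {σ γ : L ≃ₐ[RatFunc ℂ] L} (hσ : ∀ j, σ (c j) = c (j + 1))
    (hγ : ∀ j, γ (c j) = algebraMap ℂ L q * c j) (a : L) : γ (σ a) = σ (γ a) := by
  have h1 : γ * σ = σ * γ := by
    refine h.algEquiv_ext hmn hq hζ fun j => ?_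
    rw [AlgEquiv.mul_apply, AlgEquiv.mul_apply, hσ, hγ, hγ, map_mul, hσ,
      IsScalarTower.algebraMap_apply ℂ (RatFunc ℂ) L, AlgEquiv.commutes]
  exact DFunLike.congr_fun h1 a

theorem y_ne_zero (h : IsRootSystem n m ζ y c) : y ≠ 0 := by
  rintro rfl
  exact h.transcendental isAlgebraic_zero

/-- As σ^i y = ξ^i y with ξ = ζ^m of order s, fixing y forces s to divide i, and σ^s = 1. -/
theorem shift_symm_pow_eq_one [IsSplittingField (RatFunc ℂ) L (taftPoly n m)] (hmn : m ∣ n)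
    (hq : IsPrimitiveRoot q m) (hζ : IsPrimitiveRoot ζ n) (h : IsRootSystem n m ζ y c)
    {σ : L ≃ₐ[RatFunc ℂ] L} (hσ : ∀ j, σ (c j) = c (j + 1)) (i : ℕ)
    (hi : ((σ.restrictScalars ℂ).symm ^ i) y = y) : (σ.restrictScalars ℂ).symm ^ i = 1 := by
  have h1 : (σ ^ i) y = y := by
    have h2 : ((σ.restrictScalars ℂ) ^ i) (((σ.restrictScalars ℂ).symm ^ i) y) = y := by
      rw [← AlgEquiv.mul_apply, ← AlgEquiv.aut_inv, inv_pow, mul_inv_cancel]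
      rfl
    rwa [hi, AlgEquiv.restrictScalars_pow_apply] at h2
  have h3 : ∀ i : ℕ, (σ ^ i) y = algebraMap ℂ L ((ζ ^ m) ^ i) * y := by
    intro i
    induction i with
    | zero => simp
    | succ i ih =>
      rw [pow_succ', AlgEquiv.mul_apply, ih, map_mul, h.shift_y hmn hζ hσ,
        IsScalarTower.algebraMap_apply ℂ (RatFunc ℂ) L ((ζ ^ m) ^ i), AlgEquiv.commutes,
        ← IsScalarTower.algebraMap_apply, ← mul_assoc, ← map_mul, ← pow_succ]
  rw [h3] at h1
  have h4 := (algebraMap ℂ L).injective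
    ((mul_eq_right₀ h.y_ne_zero).1 h1 |>.trans (map_one (algebraMap ℂ L)).symm)
  obtain ⟨d, rfl⟩ := ((isPrimitiveRoot_pow hmn hζ).pow_eq_one_iff_dvd i).1 h4
  rw [pow_mul, OreExt.symm_pow_eq_one _
    (AlgEquiv.restrictScalars_pow_eq_one ℂ (h.shift_pow hmn hq hζ hσ)), one_pow]

theorem finite_center [IsSplittingField (RatFunc ℂ) L (taftPoly n m)] (hmn : m ∣ n)
    (hq : IsPrimitiveRoot q m) (hζ : IsPrimitiveRoot ζ n) (h : IsRootSystem n m ζ y c)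
    {σ : L ≃ₐ[RatFunc ℂ] L} (hσ : ∀ j, σ (c j) = c (j + 1)) :
    Module.Finite (Subring.center (OreExt (σ.restrictScalars ℂ)))
      (OreExt (σ.restrictScalars ℂ)) :=
  have := IsSplittingField.finiteDimensional (K := RatFunc ℂ) L (taftPoly n m)
  have := neZero_div hmn
  OreExt.finite_center (F := RatFunc ℂ) _ σ.commutes
    (AlgEquiv.restrictScalars_pow_eq_one ℂ (h.shift_pow hmn hq hζ hσ))

theorem exists_taft_action [IsSplittingField (RatFunc ℂ) L (taftPoly n m)] (hmn : m ∣ n)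
    (hq : IsPrimitiveRoot q m) (hζ : IsPrimitiveRoot ζ n)
    (h : IsRootSystem n m ζ y c) {σ : L ≃ₐ[RatFunc ℂ] L} (hσ : ∀ j, σ (c j) = c (j + 1))
    {α : ℂ} (hα : α ≠ 0) (i : ZMod (n / m)) (β : ℂ) (hβ : β ^ m = α) :
    ∃ ρ : HopfAction ℂ (GenTaft n m α hq) (TaftQ σ),
      (∀ j, ρ.act (GenTaft.g n m α hq) (TaftQ.C σ (c j)) = q • TaftQ.C σ (c j)) ∧
      ρ.act (GenTaft.g n m α hq) (TaftQ.t σ) = ζ • TaftQ.t σ ∧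
      (∀ a : TaftQ σ, ρ.act (GenTaft.x n m α hq) a =
        β • (TaftQ.C σ (c i) * a - ρ.act (GenTaft.g n m α hq) a * TaftQ.C σ (c i))) ∧
      (Function.Injective fun j : Fin n => ρ.act (GenTaft.g n m α hq) ^ (j : ℕ)) ∧
      (1 < m → ρ.act (GenTaft.x n m α hq) ≠ 0) ∧
      Nonempty (Module.Basis (Fin n) ρ.invariants (TaftQ σ)) := by
  have := h.finite_center hmn hq hζ hσ
  obtain ⟨γ, hγ⟩ := h.exists_scale hmn hq hζ
  set σ' := σ.restrictScalars ℂ with hσ'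
  have hγm : γ ^ m = 1 := h.scale_pow hmn hq hζ hγ
  have hγn : γ ^ n = 1 := by
    obtain ⟨d, hd⟩ := hmn
    rw [hd, pow_mul, hγm, one_pow]
  let Γ : TaftQ σ →ₐ[ℂ] TaftQ σ := CenterFrac.scale σ' (γ.restrictScalars ℂ)
    (h.scale_comm hmn hq hζ hσ hγ) ζ (NeZero.ne n)
    (AlgEquiv.restrictScalars_pow_eq_one ℂ hγn) hζ.pow_eq_one
  have hΓn : Γ ^ n = 1 := CenterFrac.scale_pow_eq_one ..
  have hΓC : ∀ a, Γ (TaftQ.C σ a) = TaftQ.C σ (γ a) := CenterFrac.scale_C _ _ _ _ _ _ _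
  have hCz : ∀ z : ℂ, TaftQ.C σ (algebraMap ℂ L z) = algebraMap ℂ (TaftQ σ) z := fun z => rfl
  have hΓt : Γ (TaftQ.t σ) = ζ • TaftQ.t σ := CenterFrac.scale_t ..
  have hΓc : ∀ j, Γ (TaftQ.C σ (c j)) = q • TaftQ.C σ (c j) := fun j => by
    rw [hΓC, hγ, map_mul, hCz, Algebra.smul_def]
  have hΓCm : ∀ (l : ℕ) (a : L), (Γ ^ l) (TaftQ.C σ a) = TaftQ.C σ ((γ ^ l) a) := by
    intro l
    induction l with
    | zero => intro a; rfl
    | succ l ih => intro a; rw [pow_succ, AlgHom.mul_apply, hΓC, ih, pow_succ, AlgEquiv.mul_apply]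
  have hΓtm : ∀ l : ℕ, (Γ ^ l) (TaftQ.t σ) = ζ ^ l • TaftQ.t σ := by
    intro l
    induction l with
    | zero => simp
    | succ l ih => rw [pow_succ, AlgHom.mul_apply, hΓt, map_smul, ih, smul_smul, ← pow_succ']
  have hCt : ∀ a, TaftQ.C σ a * TaftQ.t σ = TaftQ.t σ * TaftQ.C σ (σ a) := fun a => by
    change num (OreExt.C σ' a) * num (OreExt.t σ') = num (OreExt.t σ') * num (OreExt.C σ' (σ a))
    rw [← map_mul, ← map_mul, OreExt.C_mul_t]
    rfl
  -- Conjugation by y is Γ^m: both are trivial on L and multiply t by ζ^m.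
  have hconj : ∀ a : TaftQ σ, TaftQ.C σ y * a = (Γ ^ m) a * TaftQ.C σ y := by
    intro a
    refine CenterFrac.semiconj_ext σ' (φ := ((Γ ^ m : TaftQ σ →ₐ[ℂ] TaftQ σ) : TaftQ σ →+* TaftQ σ))
      (z := TaftQ.C σ y) (fun b => ?_) ?_ a
    · change TaftQ.C σ y * TaftQ.C σ b = (Γ ^ m) (TaftQ.C σ b) * TaftQ.C σ y
      rw [hΓCm, hγm, ← map_mul, ← map_mul, mul_comm]
      rfl
    · change TaftQ.C σ y * TaftQ.t σ = (Γ ^ m) (TaftQ.t σ) * TaftQ.C σ y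
      rw [hCt, h.shift_y hmn hζ hσ, hΓtm, map_mul, hCz, ← mul_assoc, ← Algebra.commutes,
        ← Algebra.smul_def]
  have hcm : ∀ a : TaftQ σ, TaftQ.C σ (c i) ^ m * a - (Γ ^ m) a * TaftQ.C σ (c i) ^ m =
      a - (Γ ^ m) a := by
    intro a
    rw [← map_pow, h.c_pow, map_add, map_mul, map_one, add_mul, mul_add, one_mul, mul_one, mul_assoc,
      hconj, hCz, ← mul_assoc ((Γ ^ m) a), ← Algebra.commutes, mul_assoc]
    abel
  obtain ⟨ρ, hg, hx⟩ := GenTaft.exists_hopfAction (hq := hq) Γ hΓn (TaftQ.C σ (c i)) (hΓc i) hcm β hβ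
  have hβ0 : β ≠ 0 := by
    rintro rfl
    rw [zero_pow (NeZero.ne m)] at hβ
    exact hα hβ.symm
  have ht0 : TaftQ.t σ ≠ 0 := fun h0 =>
    OreExt.t_ne_zero σ' (num_injective (h0.trans (map_zero num).symm))
  have hgp : ∀ (l : ℕ) (a : TaftQ σ), (ρ.act (GenTaft.g n m α hq) ^ l) a = (Γ ^ l) a := by
    intro l
    induction l with
    | zero => intro a; rfl
    | succ l ih => intro a; rw [pow_succ, Module.End.mul_apply, ih, hg, pow_succ, AlgHom.mul_apply]
  refine ⟨ρ, fun j => by rw [hg, hΓc], by rw [hg, hΓt], fun a => by rw [hx, hg], ?_, ?_, ?_⟩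
  · intro j l hjl
    have h1 := DFunLike.congr_fun hjl (TaftQ.t σ)
    simp only [hgp, hΓtm] at h1
    exact Fin.ext (hζ.pow_inj j.2 l.2 (smul_left_injective ℂ ht0 h1))
  · intro hm h0
    -- Here x · c_i = β(1 - q) c_i², which is nonzero since m > 1 gives q ≠ 1.
    have h1 := hx (TaftQ.C σ (c i))
    rw [h0, hΓc, LinearMap.zero_apply, smul_mul_assoc, ← map_mul] at h1
    have h2 : TaftQ.C σ (c i * c i) - q • TaftQ.C σ (c i * c i) =
        (1 - q) • TaftQ.C σ (c i * c i) := by rw [sub_smul, one_smul]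
    rw [h2, smul_smul, eq_comm, smul_eq_zero] at h1
    rcases h1 with h1 | h1
    · rcases mul_eq_zero.1 h1 with h1 | h1
      · exact hβ0 h1
      · exact hq.ne_one hm (sub_eq_zero.1 h1).symm
    · have h3 := (map_eq_zero (TaftQ.C σ)).1 h1
      exact mul_ne_zero (h.c_ne_zero hζ i) (h.c_ne_zero hζ i) h3
  · have ht : IsUnit (TaftQ.t σ) := isUnit_of_ne_zero ht0
    obtain ⟨u, hu⟩ := ht
    obtain ⟨b, -⟩ := exists_basis_pow_of_eigenvector (Nat.cast_ne_zero.2 (NeZero.ne n)) hζ Γ hΓn u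
      (by rw [hu, hΓt]) ρ.invariants (fun a => by
        rw [GenTaft.mem_invariants_iff, hg, hx, and_iff_left_iff_imp]
        -- For a fixed by Γ, `hconj` says that a commutes with y, hence with L and with c_i; so x ·
        -- a = 0 is automatic and the invariants are the fixed ring of Γ.
        intro ha
        have hpow : ∀ l : ℕ, (Γ ^ l) a = a := by
          intro l
          induction l with
          | zero => rfl
          | succ l ih => rw [pow_succ, AlgHom.mul_apply, ha, ih]
        have h1 := hconj a
        rw [hpow] at h1
        have h2 := CenterFrac.commute_C_of_commute_C σ'
          (h.shift_symm_pow_eq_one hmn hq hζ hσ) h1 (c i)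
        rw [ha, sub_eq_zero.2 (show TaftQ.C σ (c i) * a = a * TaftQ.C σ (c i) from h2), smul_zero])
    exact ⟨b⟩

end IsRootSystem

end

theorem proposition3p4 (n m : ℕ) [NeZero n] [NeZero m] (hmn : m ∣ n) (q ζ : ℂ)
    (hq : IsPrimitiveRoot q m) (hζ : IsPrimitiveRoot ζ n) (hζq : ζ ^ (n / m) = q)
    (α : ℂ) (hα : α ≠ 0)
    {L : Type*} [Field L] [Algebra (RatFunc ℂ) L] [Algebra ℂ L] [IsScalarTower ℂ (RatFunc ℂ) L]
    [Polynomial.IsSplittingField (RatFunc ℂ) L (taftPoly n m)] :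
    Module.finrank ℂ (GenTaft n m α hq) = n * m ∧
    (∃ (y : L) (c : ZMod (n / m) → L), IsRootSystem n m ζ y c) ∧
    ∀ (y : L) (c : ZMod (n / m) → L), IsRootSystem n m ζ y c →
      (∃! σ : L ≃ₐ[RatFunc ℂ] L, ∀ j, σ (c j) = c (j + 1)) ∧
      ∀ σ : L ≃ₐ[RatFunc ℂ] L, (∀ j, σ (c j) = c (j + 1)) →
        -- `Q` is a division algebra, finite over its center
        Nontrivial (TaftQ σ) ∧ (∀ a : TaftQ σ, a ≠ 0 → IsUnit a) ∧
        Module.Finite (Subring.center (TaftQ σ)) (TaftQ σ) ∧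
        ∀ (i : ZMod (n / m)) (β : ℂ), β ^ m = α →
          ∃ ρ : HopfAction ℂ (GenTaft n m α hq) (TaftQ σ),
            -- the action
            (∀ j, ρ.act (GenTaft.g n m α hq) (TaftQ.C σ (c j)) = q • TaftQ.C σ (c j)) ∧
            ρ.act (GenTaft.g n m α hq) (TaftQ.t σ) = ζ • TaftQ.t σ ∧
            (∀ a : TaftQ σ, ρ.act (GenTaft.x n m α hq) a =
              β • (TaftQ.C σ (c i) * a - ρ.act (GenTaft.g n m α hq) a * TaftQ.C σ (c i))) ∧
            -- its properties
            ρ.IsInnerFaithful ∧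
            Module.finrank ρ.invariants (TaftQ σ) = n / m * m ∧
            (2 ≤ m → n / m * m < n * m ∧ ¬ ρ.IsHopfGalois) := by
  have := Polynomial.IsSplittingField.finiteDimensional (K := RatFunc ℂ) L (taftPoly n m)
  have := IsRootSystem.isGalois (L := L) n m
  have hdiv : n / m * m = n := Nat.div_mul_cancel hmn
  have hdim : Module.finrank ℂ (GenTaft n m α hq) = n * m := by
    obtain ⟨y, c, h⟩ := exists_isRootSystem (L := L) hmn hζ
    obtain ⟨σ, hσ⟩ := h.exists_shift hmn hq hζ
    -- The dimension of T is read off from one of the actions, for which any m-th root of α will do.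
    obtain ⟨β, hβ⟩ := IsAlgClosed.exists_pow_nat_eq α (NeZero.pos m)
    obtain ⟨ρ, -, -, -, hg, hx, -⟩ := h.exists_taft_action hmn hq hζ hσ hα 0 β hβ
    exact GenTaft.finrank_eq_of_hopfAction ρ hg hx
  refine ⟨hdim, exists_isRootSystem hmn hζ, fun y c h => ⟨?_, fun σ hσ => ?_⟩⟩
  · obtain ⟨σ, hσ⟩ := h.exists_shift hmn hq hζ
    exact ⟨σ, hσ, fun τ hτ => h.algEquiv_ext hmn hq hζ fun j => by rw [hτ, hσ]⟩
  · have := h.finite_center hmn hq hζ hσ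
    have hunit : ∀ a : TaftQ σ, a ≠ 0 → IsUnit a := fun a ha => CenterFrac.isUnit_of_ne_zero ha
    refine ⟨inferInstance, hunit, inferInstance, fun i β hβ => ?_⟩
    obtain ⟨ρ, h1, h2, h3, hg, hx, ⟨b⟩⟩ := h.exists_taft_action hmn hq hζ hσ hα i β hβ
    refine ⟨ρ, h1, h2, h3, GenTaft.isInnerFaithful ρ hg hx, ?_, fun hm => ?_⟩
    · have := strongRankCondition_of_isUnit (ρ.isUnit_invariants hunit)
      rw [Module.finrank_eq_card_basis b, Fintype.card_fin, hdiv]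
    · have hlt : n < n * m := lt_mul_of_one_lt_right (NeZero.pos n) hm
      have := strongRankCondition_of_isUnit hunit
      refine ⟨by rwa [hdiv], ρ.not_isHopfGalois b b.span_eq.ge ?_⟩
      rwa [Fintype.card_fin, hdim]
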